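/- **Online local learning.** There are $n$ items and a label set $[L]$. In each round $t=1,\dots,T$ the learner is shown a pair $(i_t,j_t)$ of distinct items and answers with a pair of labels; then a payoff function $P_t:[L]^2\to[-1,1]$ is revealed, and the learner receives the payoff of its pair of labels. The learner is randomized. On a fixed sequence of pairs and payoff functions its regret is $\mathrm{OPT}-\mathbb E[\text{total payoff}]$, where $\mathrm{OPT}=\max_{\ell\in[L]^n}\sum_{t}P_t(\ell(i_t),\ell(j_t))$ and the expectation is over the coin tosses of the learner. Payoffs are rational. A polynomial-time learner is told parameters $(N,n,L,T)$ in unary, where $N$ is a scale parameter, uses a number of fair coins polynomial in $N+n+L+T$, and computes each answer from the parameters, its coins, the past rounds and the current pair in time polynomial in the length of these data (payoffs are written in binary). For a sequence $\beta=\beta(N)$ of reals, regret $O(\sqrt{nL^{\beta}T})$ is *achievable in polynomial time* if there are a polynomial-time learner and a constant $C$ such that for all sufficiently large $N$ and all $n\le N$, $1\le L\le N$, $T\le N^2$, its regret with parameters $(N,n,L,T)$ is at most $C\sqrt{nL^{\beta(N)}T}$ on every sequence of $T$ rounds. (If $\beta$ is constant, this holds in particular if a learner that is not told $N$, with running time polynomial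 in $n$, $L$, $T$ and the length of the payoffs, has regret at most $C\sqrt{nL^{\beta}T}$ for all $n,L,T$.) **Random graphs.** $G(n,p)$ is the binomial random graph on $n$ vertices. $G(n,p,k,q)$ is the random graph obtained by choosing a uniformly random set $S$ of $k$ vertices and then joining each pair of vertices inside $S$ with probability $q$ and every other pair with probability $p$, all independently. **Theorem.** Let $\alpha(n),\epsilon(n),\epsilon'(n)$ be sequences of reals, and for large $n$ let $$k=\lfloor n^{1/2-\epsilon'}\rfloor,\qquad p_s=n^{-\alpha},\qquad p_d=k^{-\alpha-\epsilon}\in[0,1].$$ Suppose that $\alpha=\Omega(1)$, $\alpha\le\frac12$ for large $n$, $\epsilon=\Omega(1)$, $\epsilon'=\Omega(1)$, $k=n^{\Omega(1)}$ (that is, $k\ge n^{c}$ for some constant $c>0$ and all large $n$) and $p_s=o(p_d)$. Let $\delta(n)$ be a sequence with $\delta(n)\log n\to\infty$, that is, $\delta=\omega(1/\log n)$, and put $$\beta(n)=2\,\frac{\frac12-\left(\frac12-\epsilon'(n)\right)\left(\alpha(n)+\epsilon(n)\right)-\delta(n)}{\frac12+\epsilon'(n)}-1 .$$ If regret $O(\sqrt{nL^{\beta}T})$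 is achievable in polynomial time for online local learning, then there is a randomized polynomial-time algorithm that distinguishes $G(n,p_s)$ from $G(n,p_s,k,p_d)$ with probability $\frac45$: for all sufficiently large $n$, on input a graph drawn from $G(n,p_s)$ it answers "random" with probability at least $\frac45$, and on input a graph drawn from $G(n,p_s,k,p_d)$ it answers "planted" with probability at least $\frac45$, where the probability is over the graph and the coin tosses of the algorithm. -/

import Mathlib

open Filter MeasureTheory Asymptotics

/-! ## A machine model with a step count

Data are binary trees; programs are first-order while-programs that map one tree to one tree. -/

/-- Binary trees, the data of the machine model. -/
inductive Val where
  | leaf : Val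
  | node : Val → Val → Val

/-- The number of nodes and leaves of a tree: the length of the input or output it represents. -/
def Val.size : Val → ℕ
  | .leaf => 1
  | .node a b => a.size + b.size + 1

/-- While-programs over binary trees. `leaf` is false, and every other tree is true. -/
inductive Prog where
  /-- return the leaf -/
  | nil : Prog
  /-- return the input -/
  | id : Prog
  /-- return the left subtree of the input (a leaf on a leaf) -/
  | left : Prog
  /-- return the right subtree of the input (a leaf on a leaf) -/
  | right : Prog
  /-- run both programs on the input and return the two results as one tree -/
  | pair : Prog → Prog → Prog
  /-- `comp g f`: run `f`, then run `g` on its result -/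
  | comp : Prog → Prog → Prog
  /-- `ite c f g`: run `f` on the input if the test `c` succeeds on it, else run `g` on it -/
  | ite : Prog → Prog → Prog → Prog
  /-- `loop c f`: while the test `c` succeeds on the current value, replace the value by
  the result of `f` on it -/
  | loop : Prog → Prog → Prog

/-- `Prog.Runs f x y t`: on input `x` the program `f` halts with output `y` after time `t`.
Each elementary operation is charged the size of the value it works on (so time is never less than
the size of the output, and copying a large value is not free). -/
inductive Prog.Runs : Prog → Val → Val → ℕ → Prop where
  | nil (x : Val) : Runs .nil x .leaf x.size
  | id (x : Val) : Runs .id x x x.size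
  | left_leaf : Runs .left .leaf .leaf 1
  | left_node (a b : Val) : Runs .left (.node a b) a (Val.node a b).size
  | right_leaf : Runs .right .leaf .leaf 1
  | right_node (a b : Val) : Runs .right (.node a b) b (Val.node a b).size
  | pair {f g : Prog} {x a b : Val} {s t : ℕ} :
      Runs f x a s → Runs g x b t → Runs (.pair f g) x (.node a b) (s + t + x.size)
  | comp {f g : Prog} {x y z : Val} {s t : ℕ} :
      Runs f x y s → Runs g y z t → Runs (.comp g f) x z (s + t + x.size)
  | ite_true {c f g : Prog} {x a b y : Val} {s t : ℕ} :
      Runs c x (.node a b) s → Runs f x y t → Runs (.ite c f g) x y (s + t + x.size)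
  | ite_false {c f g : Prog} {x y : Val} {s t : ℕ} :
      Runs c x .leaf s → Runs g x y t → Runs (.ite c f g) x y (s + t + x.size)
  | loop_stop {c f : Prog} {x : Val} {s : ℕ} :
      Runs c x .leaf s → Runs (.loop c f) x x (s + x.size)
  | loop_step {c f : Prog} {x a b y z : Val} {s t u : ℕ} :
      Runs c x (.node a b) s → Runs f x y t → Runs (.loop c f) y z u →
        Runs (.loop c f) x z (s + t + u + x.size)

/-! ## Encodings of inputs and outputs -/

/-- Lists, as right combs. -/
def Val.ofList {γ : Type*} (enc : γ → Val) : List γ → Val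
  | [] => .leaf
  | c :: l => .node (enc c) (Val.ofList enc l)

/-- Truth values. -/
def Val.ofBool (b : Bool) : Val := cond b (.node .leaf .leaf) .leaf

/-- Natural numbers in unary. -/
def Val.ofUnary : ℕ → Val
  | 0 => .leaf
  | n + 1 => .node .leaf (Val.ofUnary n)

/-- Natural numbers in binary. -/
def Val.ofBinary (n : ℕ) : Val := Val.ofList Val.ofBool n.bits

/-- Rational numbers: sign, numerator and denominator in binary. -/
def Val.ofRat (x : ℚ) : Val :=
  .node (Val.ofBool (decide (x < 0))) (.node (Val.ofBinary x.num.natAbs) (Val.ofBinary x.den))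

/-- Strings of coin tosses. -/
def Val.ofCoins {m : ℕ} (r : Fin m → Bool) : Val := Val.ofList Val.ofBool (List.ofFn r)

open Classical in
/-- Graphs, by their adjacency matrix. -/
noncomputable def Val.ofGraph {n : ℕ} (G : SimpleGraph (Fin n)) : Val :=
  Val.ofList (fun u => Val.ofList (fun v => Val.ofBool (decide (G.Adj u v))) (List.finRange n))
    (List.finRange n)

/-! ## Online local learning -/

/-- The parameters of a game: `items` items, `labels` labels, `rounds` rounds. The number `scale`
is an extra parameter shown to the learner, on which the exponent in the regret may depend. -/
structure GameSize where
  scale : ℕ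
  items : ℕ
  labels : ℕ
  rounds : ℕ
  labels_pos : 0 < labels

/-- One round: a pair of items, and a payoff in `[-1, 1]` for each pair of labels. -/
structure Round (n L : ℕ) where
  fst : Fin n
  snd : Fin n
  distinct : fst ≠ snd
  payoff : Fin L → Fin L → ℚ
  bounded : ∀ a b, |payoff a b| ≤ 1

/-- A query, or an answer: two numbers. -/
def Val.ofPair {m : ℕ} (x : Fin m × Fin m) : Val :=
  .node (Val.ofUnary x.1) (Val.ofUnary x.2)

/-- What the learner sees of a past round: the pair of items and the payoff function. -/
def Val.ofRound {n L : ℕ} (R : Round n L) : Val :=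
  .node (Val.ofPair (R.fst, R.snd))
    (Val.ofList (fun a => Val.ofList (fun b => Val.ofRat (R.payoff a b)) (List.finRange L))
      (List.finRange L))

/-- The parameters of a game, in unary. -/
def Val.ofGameSize (s : GameSize) : Val :=
  .node (Val.ofUnary s.scale)
    (.node (Val.ofUnary s.items) (.node (Val.ofUnary s.labels) (Val.ofUnary s.rounds)))

/-- All that a learner may use in a round: the parameters, its coin tosses, the past rounds,
and the pair of items in question. -/
def learnerInput (s : GameSize) {m : ℕ} (r : Fin m → Bool) (past : List (Round s.items s.labels))
    (x : Fin s.items × Fin s.items) : Val :=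
  .node (Val.ofGameSize s)
    (.node (Val.ofCoins r) (.node (Val.ofList Val.ofRound past) (Val.ofPair x)))

/-- A randomized polynomial-time learner. Its coins (polynomially many in the parameters) are
tossed before the game and stay available in all rounds. In each round a fixed program computes the
pair of labels, in time polynomial in the total length of what the learner has been shown. (A
learner with a memory is covered: its memory is a function of its coins and the past rounds, and
can be recomputed.) -/
structure Learner where
  prog : Prog
  coins : Polynomial ℕ
  time : Polynomial ℕ
  predict : (s : GameSize) →
    (Fin (coins.eval (s.scale + s.items + s.labels + s.rounds)) → Bool) →
    List (Round s.items s.labels) → Fin s.items × Fin s.items → Fin s.labels × Fin s.labels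
  runs : ∀ s r past x, past.length < s.rounds → x.1 ≠ x.2 →
    ∃ t ≤ time.eval (learnerInput s r past x).size,
      prog.Runs (learnerInput s r past x) (Val.ofPair (predict s r past x)) t

/-- The total payoff of the best fixed labeling. -/
noncomputable def opt {n L T : ℕ} (σ : Fin T → Round n L) : ℝ :=
  ⨆ l : Fin n → Fin L, ∑ t, ((σ t).payoff (l (σ t).fst) (l (σ t).snd) : ℝ)

/-- The expected total payoff of a learner, over its coin tosses. In round `t` it knows the rounds
before `t` and the pair of items of round `t`. -/
noncomputable def Learner.expectedPayoff (A : Learner) (s : GameSize)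
    (σ : Fin s.rounds → Round s.items s.labels) : ℝ :=
  Finset.expect Finset.univ fun r => ∑ t : Fin s.rounds,
    let y := A.predict s r ((List.ofFn σ).take (t : ℕ)) ((σ t).fst, (σ t).snd)
    ((σ t).payoff y.1 y.2 : ℝ)

/-- The regret of a learner on a sequence of rounds. -/
noncomputable def Learner.regret (A : Learner) (s : GameSize)
    (σ : Fin s.rounds → Round s.items s.labels) : ℝ :=
  opt σ - A.expectedPayoff s σ

/-- The learner has regret `O(√(n L ^ β(N) T))` on all games with `n` items, `L` labels and `T`
rounds whose parameters are bounded by `n, L ≤ N` and `T ≤ N²`, where `N` is the scale. -/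
def Learner.AchievesRegret (A : Learner) (β : ℕ → ℝ) : Prop :=
  ∃ C : ℝ, ∀ᶠ N in atTop, ∀ s : GameSize, s.scale = N →
    s.items ≤ N → s.labels ≤ N → s.rounds ≤ N ^ 2 →
    ∀ σ : Fin s.rounds → Round s.items s.labels,
      A.regret s σ ≤ C * √((s.items : ℝ) * (s.labels : ℝ) ^ β N * (s.rounds : ℝ))

/-! ## Random graphs and distinguishers -/

/-- The graph that agrees with `K` on pairs of vertices inside `S`, and with `H` elsewhere. -/
def plant {V : Type*} (S : Finset V) (H K : SimpleGraph V) : SimpleGraph V where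
  Adj u v := (u ∈ S ∧ v ∈ S ∧ K.Adj u v) ∨ (¬ (u ∈ S ∧ v ∈ S) ∧ H.Adj u v)
  symm := ⟨fun u v h => by
    rcases h with ⟨h1, h2, h3⟩ | ⟨h1, h2⟩
    · exact Or.inl ⟨h2, h1, h3.symm⟩
    · exact Or.inr ⟨fun h => h1 ⟨h.2, h.1⟩, h2.symm⟩⟩
  loopless := ⟨fun u h => by
    rcases h with ⟨_, _, h⟩ | ⟨_, h⟩
    · exact K.loopless.irrefl u h
    · exact H.loopless.irrefl u h⟩

/-- The random graph `G(n, p, k, q)`: for a uniformly random set `S` of `k` vertices, the pairs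
inside `S` are edges with probability `q` and the other pairs with probability `p`,
independently. -/
noncomputable def plantedRandom (n : ℕ) (p : unitInterval) (k : ℕ) (q : unitInterval) :
    Measure (SimpleGraph (Fin n)) :=
  (n.choose k : ENNReal)⁻¹ • ∑ S ∈ Finset.powersetCard k (Finset.univ : Finset (Fin n)),
    ((SimpleGraph.binomialRandom (Fin n) p).prod (SimpleGraph.binomialRandom (Fin n) q)).map
      fun HK => plant S HK.1 HK.2

/-- A randomized polynomial-time algorithm that takes a graph and answers `true` ("planted") or
`false` ("not planted"). -/
structure Distinguisher where
  prog : Prog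
  coins : Polynomial ℕ
  time : Polynomial ℕ
  verdict : (n : ℕ) → SimpleGraph (Fin n) → (Fin (coins.eval n) → Bool) → Bool
  runs : ∀ n G r, ∃ t ≤ time.eval n,
    prog.Runs (.node (Val.ofGraph G) (Val.ofCoins r)) (Val.ofBool (verdict n G r)) t

/-- The probability that the answer on a random graph with law `μ` is `b`, over the graph and
independent uniform coin tosses. -/
noncomputable def Distinguisher.answerProb (D : Distinguisher) {n : ℕ}
    (μ : Measure (SimpleGraph (Fin n))) (b : Bool) : ℝ :=
  (μ.prod (ProbabilityTheory.uniformOn Set.univ)).real {x | D.verdict n x.1 x.2 = b}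

/-! ### Polynomials with natural coefficients -/

/-! Split the vertices into `2 * m` blocks of `L = n / (2 * m)` vertices, with `m = k / 40`. Blocks
are items, the vertices of a block are its labels, and each of the `m * m` pairs (lower block, upper
block) is asked once, the payoff being adjacency of the two chosen vertices.

In the null model each round queries edges about which the past rounds say nothing, so the payoffs
are independent Bernoulli(`p`) variables however the learner plays (`integral_exp_gain`), and its
total is about `p * m²`. In the planted model a block contains about 20 planted vertices on average,
so most blocks meet `S` (`card_many_missed_le`). Choosing a vertex of `S` in every such block gives
a labeling worth at least `q * m² / 16` with high probability (`exists_labeling_of_countAdj`,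
`measureReal_labelValue_lt_le`). Up to constants, `L ^ β` is at most `k * q² * n ^ (-2δ)`
(`labels_rpow_le`), and `n ^ (-2δ)` tends to 0, so the regret is below `q * m² / 32`
(`regret_bounds`). The learner then earns order `q * m²` on average, far above `p * m²`.

Three points need care. The parameters `k`, `p`, `q` need not be computable, so the test `Exceeds`
tries every `m` and estimates `p` by the edge density of the input, whose order the planting does
not change; a margin `3 * m` makes the error probabilities summable over `m`
(`measureReal_exceeds_le`). The regret bound concerns only the mean, so the learner is run `n` times
with fresh coins (`uniformOn_not_exceeds_le`). The margin is affordable only if `q * m` exceeds a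
constant; this holds because no learner has regret below 1 on one-round games
(`exists_one_le_regret`), which bounds `L ^ β`, and hence `k * q²`, from below.

That the test runs in polynomial time (`polyTime_exceeds`) follows from closure properties of
`PolyTime`, a predicate on families of encoded data. -/

theorem Polynomial.eval_nat_mono (P : Polynomial ℕ) {a b : ℕ} (h : a ≤ b) :
    P.eval a ≤ P.eval b := by
  rw [Polynomial.eval_eq_sum, Polynomial.eval_eq_sum]
  exact Finset.sum_le_sum fun i _ => Nat.mul_le_mul_left _ (Nat.pow_le_pow_left h i)

/-! ### Polynomial-time computable functions on encoded data -/

theorem Val.size_pos (x : Val) : 0 < x.size := by cases x <;> simp [Val.size]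

theorem Prog.Runs.size_le {F : Prog} {x y : Val} {t : ℕ} (h : F.Runs x y t) : y.size ≤ t := by
  induction h with
  | pair _ _ h1 h2 =>
    rename_i x _ _ _ _ _ _
    have := x.size_pos
    simp only [Val.size]
    omega
  | nil x => exact x.size_pos
  | _ => first | omega | simp only [Val.size]; omega

/-- The map that sends the datum encoded by `e i` to `f i` is computable in polynomial time. -/
def PolyTime {ι : Type*} (e f : ι → Val) : Prop :=
  ∃ (F : Prog) (P : Polynomial ℕ), ∀ i, ∃ t ≤ P.eval (e i).size, F.Runs (e i) (f i) t

/-- A polynomial-time computable function with values in the natural numbers in unary. -/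
def PolyNat {ι : Type*} (e : ι → Val) (f : ι → ℕ) : Prop :=
  PolyTime e fun i => Val.ofUnary (f i)

namespace PolyTime
variable {ι κ : Type*} {e f g : ι → Val}

theorem size_le (hf : PolyTime e f) : ∃ P : Polynomial ℕ, ∀ i, (f i).size ≤ P.eval (e i).size := by
  obtain ⟨F, P, hF⟩ := hf
  refine ⟨P, fun i => ?_⟩
  obtain ⟨t, ht, hr⟩ := hF i
  exact hr.size_le.trans ht

theorem refl (e : ι → Val) : PolyTime e e :=
  ⟨.id, .X, fun i => ⟨_, by simp, .id _⟩⟩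

theorem leaf (e : ι → Val) : PolyTime e fun _ => .leaf :=
  ⟨.nil, .X, fun i => ⟨_, by simp, .nil _⟩⟩

theorem pair (hf : PolyTime e f) (hg : PolyTime e g) :
    PolyTime e fun i => .node (f i) (g i) := by
  obtain ⟨F, P, hF⟩ := hf
  obtain ⟨G, Q, hG⟩ := hg
  refine ⟨.pair F G, P + Q + .X, fun i => ?_⟩
  obtain ⟨s, hs, hs'⟩ := hF i
  obtain ⟨t, ht, ht'⟩ := hG i
  exact ⟨_, by simp; omega, .pair hs' ht'⟩

/-- Time is never below output size, so the second program starts from a value of polynomial size.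
-/
theorem trans (hf : PolyTime e f) (hg : PolyTime f g) : PolyTime e g := by
  obtain ⟨F, P, hF⟩ := hf
  obtain ⟨G, Q, hG⟩ := hg
  refine ⟨.comp G F, P + Q.comp P + .X, fun i => ?_⟩
  obtain ⟨s, hs, hs'⟩ := hF i
  obtain ⟨t, ht, ht'⟩ := hG i
  refine ⟨_, ?_, .comp hs' ht'⟩
  have := Q.eval_nat_mono (hs'.size_le.trans hs)
  simp [Polynomial.eval_comp]
  omega

theorem comap (hf : PolyTime e f) (φ : κ → ι) : PolyTime (fun x => e (φ x)) fun x => f (φ x) := by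
  obtain ⟨F, P, hF⟩ := hf
  exact ⟨F, P, fun x => hF (φ x)⟩

theorem left (hf : PolyTime e fun i => .node (f i) (g i)) : PolyTime e f :=
  hf.trans ⟨.left, .X, fun i => ⟨_, by simp, .left_node _ _⟩⟩

theorem right (hf : PolyTime e fun i => .node (f i) (g i)) : PolyTime e g :=
  hf.trans ⟨.right, .X, fun i => ⟨_, by simp, .right_node _ _⟩⟩

theorem const (e : ι → Val) (v : Val) : PolyTime e fun _ => v := by
  induction v with
  | leaf => exact leaf e
  | node a b ha hb => exact ha.pair hb

/-- A loop whose state runs through `V i (N i), …, V i 0`. -/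
theorem loop {V : ι → ℕ → Val} {N : ι → ℕ} {c : ι → ℕ → Val} (hinit : PolyTime e fun i => V i (N i))
    (htest : PolyTime (fun x : (i : ι) × Fin (N i + 1) => V x.1 x.2) fun x => c x.1 x.2)
    (hc₀ : ∀ i, c i 0 = .leaf) (hc : ∀ i, ∀ j < N i, c i (j + 1) ≠ .leaf)
    (hstep : PolyTime (fun x : (i : ι) × Fin (N i) => V x.1 (x.2 + 1)) fun x => V x.1 x.2)
    (hN : ∃ Q : Polynomial ℕ, ∀ i, N i ≤ Q.eval (e i).size)
    (hV : ∃ Q : Polynomial ℕ, ∀ i, ∀ j ≤ N i, (V i j).size ≤ Q.eval (e i).size) :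
    PolyTime e fun i => V i 0 := by
  obtain ⟨F₀, P₀, h₀⟩ := hinit
  obtain ⟨C, PC, hC⟩ := htest
  obtain ⟨F, P, hF⟩ := hstep
  obtain ⟨QN, hN⟩ := hN
  obtain ⟨QV, hV⟩ := hV
  refine ⟨.comp (.loop C F) F₀, P₀ + (QN + 1) * (PC.comp QV + P.comp QV + QV) + .X, fun i => ?_⟩
  -- From state `j` there remain `j` iterations and a final test, each acting on values of size at
  -- most `QV`.
  have key : ∀ j ≤ N i, ∃ t ≤ (j + 1) * (PC.eval (QV.eval (e i).size) +
      P.eval (QV.eval (e i).size) + QV.eval (e i).size),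
      (Prog.loop C F).Runs (V i j) (V i 0) t := by
    intro j
    induction j with
    | zero =>
      intro h
      obtain ⟨s, hs, hs'⟩ := hC ⟨i, ⟨0, by omega⟩⟩
      simp only [hc₀] at hs'
      refine ⟨_, ?_, Prog.Runs.loop_stop hs'⟩
      have h1 := hV i 0 h
      have h2 := PC.eval_nat_mono h1
      simp only at hs
      omega
    | succ j ih =>
      intro h
      obtain ⟨s, hs, hs'⟩ := hC ⟨i, ⟨j + 1, by omega⟩⟩
      obtain ⟨t, ht, ht'⟩ := hF ⟨i, ⟨j, by omega⟩⟩
      obtain ⟨u, hu, hu'⟩ := ih (by omega)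
      simp only at hs hs' ht ht'
      have h1 := hV i (j + 1) h
      have h2 := PC.eval_nat_mono h1
      have h3 := P.eval_nat_mono h1
      have hne := hc i j (by omega)
      cases hcv : c i (j + 1) with
      | leaf => exact absurd hcv hne
      | node a b =>
        rw [hcv] at hs'
        refine ⟨_, ?_, .loop_step hs' ht' hu'⟩
        rw [add_mul (j + 1), one_mul]
        omega
  obtain ⟨s, hs, hs'⟩ := h₀ i
  obtain ⟨t, ht, ht'⟩ := key _ le_rfl
  refine ⟨_, ?_, .comp hs' ht'⟩
  have := Nat.mul_le_mul_right (PC.eval (QV.eval (e i).size) +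
      P.eval (QV.eval (e i).size) + QV.eval (e i).size) (Nat.succ_le_succ (hN i))
  simp only [Polynomial.eval_add, Polynomial.eval_mul, Polynomial.eval_comp, Polynomial.eval_X,
    Polynomial.eval_one]
  simp only [Nat.succ_eq_add_one] at this
  omega

end PolyTime

theorem Val.size_ofUnary (n : ℕ) : (Val.ofUnary n).size = 2 * n + 1 := by
  induction n with
  | zero => rfl
  | succ n ih => simp only [Val.ofUnary, Val.size, ih]; omega

theorem PolyNat.le {ι : Type*} {e : ι → Val} {f : ι → ℕ} (hf : PolyNat e f) :
    ∃ P : Polynomial ℕ, ∀ i, f i ≤ P.eval (e i).size := by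
  obtain ⟨P, hP⟩ := PolyTime.size_le hf
  refine ⟨P, fun i => ?_⟩
  have := hP i
  rw [Val.size_ofUnary] at this
  omega

/-- Adds a bounded loop variable to the data. -/
def Val.extend {ι : Type*} (e : ι → Val) (N : ι → ℕ) (x : (i : ι) × Fin (N i)) : Val :=
  .node (Val.ofUnary x.2) (e x.1)

namespace PolyTime
variable {ι : Type*} {e f g : ι → Val} {N : ι → ℕ}

theorem weaken (hf : PolyTime e f) : PolyTime (Val.extend e N) fun x => f x.1 :=
  (right (refl (Val.extend e N))).trans (hf.comap Sigma.fst)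

theorem var : PolyNat (Val.extend e N) fun x => x.2 := left (refl (Val.extend e N))

/-- A loop with a counter. -/
theorem bounded {s : ι → ℕ → Val} (hN : PolyNat e N) (hinit : PolyTime e fun i => s i (N i))
    (hstep : PolyTime (fun x : (i : ι) × Fin (N i) =>
      .node (Val.extend e N x) (s x.1 (x.2 + 1))) fun x => s x.1 x.2)
    (hs : ∃ Q : Polynomial ℕ, ∀ i, ∀ j ≤ N i, (s i j).size ≤ Q.eval (e i).size) :
    PolyTime e fun i => s i 0 := by
  obtain ⟨Q, hQ⟩ := hs
  obtain ⟨P, hP⟩ := hN.le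
  -- The counter and the original data travel with the state, since the machine has no other memory.
  have := loop (V := fun i j => .node (.node (Val.ofUnary j) (e i)) (s i j)) (N := N) (e := e)
    (c := fun i j => .ofUnary j) ((pair hN (refl e)).pair hinit)
    (left (left (refl _))) (fun _ => rfl) (by simp [Val.ofUnary]) ?_ ⟨P, hP⟩ ?_
  · exact this.right
  · have h0 := refl fun x : (i : ι) × Fin (N i) =>
      Val.node (.node (Val.ofUnary (x.2 + 1)) (e x.1)) (s x.1 (x.2 + 1))
    have h1 : PolyTime (fun x : (i : ι) × Fin (N i) =>
        Val.node (.node (Val.ofUnary (x.2 + 1)) (e x.1)) (s x.1 (x.2 + 1)))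
        fun x => Val.extend e N x := (right (left (left h0))).pair (right (left h0))
    exact h1.pair ((h1.pair (right h0)).trans hstep)
  · refine ⟨2 * P + .X + Q + 3, fun i j hj => ?_⟩
    have h1 := hQ i j hj
    have h2 := hP i
    simp [Val.size, Val.size_ofUnary]
    omega

theorem ite {c : ι → ℕ} (hc : PolyNat e c) (hf : PolyTime e f) (hg : PolyTime e g) :
    PolyTime e fun i => if c i = 0 then g i else f i := by
  obtain ⟨C, PC, hC⟩ := hc
  obtain ⟨F, P, hF⟩ := hf
  obtain ⟨G, Q, hG⟩ := hg
  refine ⟨.ite C F G, PC + P + Q + .X, fun i => ?_⟩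
  obtain ⟨s, hs, hs'⟩ := hC i
  obtain ⟨t, ht, ht'⟩ := hF i
  obtain ⟨u, hu, hu'⟩ := hG i
  rcases hci : c i with _ | m
  · simp only [hci] at hs'
    refine ⟨_, ?_, by simpa [hci] using .ite_false hs' hu'⟩
    simp; omega
  · simp only [hci] at hs'
    refine ⟨_, ?_, by simpa [hci] using .ite_true hs' ht'⟩
    simp; omega

theorem _root_.Val.size_ofList_le {γ : Type*} (enc : γ → Val) (l : List γ) {B : ℕ}
    (h : ∀ c ∈ l, (enc c).size ≤ B) : (Val.ofList enc l).size ≤ l.length * (B + 1) + 1 := by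
  induction l with
  | nil => simp [Val.ofList, Val.size]
  | cons a l ih =>
    have h1 := ih fun c hc => h c (by simp [hc])
    have h2 := h a (by simp)
    simp only [Val.ofList, Val.size, List.length_cons, add_mul]
    omega

/-- Tabulation of a function of a bounded variable. -/
theorem tabulate {f : ι → ℕ → Val} (hN : PolyNat e N)
    (hf : PolyTime (Val.extend e N) fun x => f x.1 x.2) :
    PolyTime e fun i => Val.ofList (f i) (List.range (N i)) := by
  -- The counter runs down, so the list is built from its end: state `j` holds the entries from `j`
  -- on.
  have := bounded (s := fun i j => Val.ofList (f i) ((List.range (N i)).drop j)) hN ?_ ?_ ?_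
  · simpa using this
  · convert leaf e using 2 with i
    simp only [List.drop_of_length_le (List.length_range (n := N i)).le, Val.ofList]
  · have h0 := refl fun x : (i : ι) × Fin (N i) => Val.node (Val.extend e N x)
      (Val.ofList (f x.1) ((List.range (N x.1)).drop (x.2 + 1)))
    have h1 := ((left h0).trans hf).pair (right h0)
    convert h1 using 2 with x
    rw [List.drop_eq_getElem_cons (by simp)]
    simp [Val.ofList]
  · obtain ⟨P, hP⟩ := hN.le
    obtain ⟨Q, hQ⟩ := hf.size_le
    refine ⟨P * (Q.comp (2 * P + .X + 2) + 1) + 1, fun i j _ => ?_⟩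
    refine (Val.size_ofList_le (B := Q.eval (2 * P.eval (e i).size + (e i).size + 2)) _ _
      fun c hc => ?_).trans ?_
    · have hc' : c < N i := by simpa using List.mem_of_mem_drop hc
      refine (hQ ⟨i, c, hc'⟩).trans (Q.eval_nat_mono ?_)
      have := hP i
      simp only [Val.extend, Val.size, Val.size_ofUnary]
      omega
    · simp only [List.length_drop, List.length_range, Polynomial.eval_add, Polynomial.eval_mul,
        Polynomial.eval_comp, Polynomial.eval_X, Polynomial.eval_one, Polynomial.eval_ofNat]
      gcongr
      have := hP i
      omega

end PolyTime

/-! ### Access to lists by position -/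

/-- The right subtree, a leaf on a leaf. -/
def Val.tail : Val → Val
  | .leaf => .leaf
  | .node _ b => b

theorem Val.size_tail_le (v : Val) : v.tail.size ≤ v.size := by
  cases v <;> simp [Val.tail, Val.size]; omega

/-- The left subtree, a leaf on a leaf. -/
def Val.head : Val → Val
  | .leaf => .leaf
  | .node a _ => a

namespace PolyTime
variable {ι : Type*} {e f g : ι → Val} {N : ι → ℕ}

theorem tail (hf : PolyTime e f) : PolyTime e fun i => (f i).tail :=
  hf.trans ⟨.right, .X, fun i => ⟨(f i).size, by simp, by
    beta_reduce; cases f i <;> [exact .right_leaf; exact .right_node _ _]⟩⟩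

theorem head (hf : PolyTime e f) : PolyTime e fun i => (f i).head :=
  hf.trans ⟨.left, .X, fun i => ⟨(f i).size, by simp, by
    beta_reduce; cases f i <;> [exact .left_leaf; exact .left_node _ _]⟩⟩

theorem drop (hN : PolyNat e N) (hf : PolyTime e f) :
    PolyTime e fun i => Val.tail^[N i] (f i) := by
  refine bounded (s := fun i j => Val.tail^[N i - j] (f i)) hN (by simpa using hf) ?_ ?_
  · have h0 := refl fun x : (i : ι) × Fin (N i) => Val.node (Val.extend e N x)
      (Val.tail^[N x.1 - (x.2 + 1)] (f x.1))
    convert tail (right h0) using 2 with x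
    rw [← Function.iterate_succ_apply' Val.tail]
    congr 2
    omega
  · obtain ⟨Q, hQ⟩ := hf.size_le
    refine ⟨Q, fun i j _ => le_trans ?_ (hQ i)⟩
    induction N i - j with
    | zero => simp
    | succ m ih =>
      rw [Function.iterate_succ_apply']
      exact (Val.size_tail_le _).trans ih

end PolyTime

theorem Val.iterate_tail_ofUnary (m n : ℕ) :
    Val.tail^[m] (Val.ofUnary n) = Val.ofUnary (n - m) := by
  induction m generalizing n with
  | zero => rfl
  | succ m ih =>
    rw [Function.iterate_succ_apply]
    cases n with
    | zero => simpa [Val.tail, Val.ofUnary] using ih 0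
    | succ n => simpa [Val.tail, Val.ofUnary] using ih n

theorem Val.iterate_tail_ofList {γ : Type*} (enc : γ → Val) (m : ℕ) (l : List γ) :
    Val.tail^[m] (Val.ofList enc l) = Val.ofList enc (l.drop m) := by
  induction m generalizing l with
  | zero => rfl
  | succ m ih =>
    rw [Function.iterate_succ_apply]
    cases l with
    | nil => simpa [Val.tail, Val.ofList] using ih []
    | cons a l => simpa [Val.tail, Val.ofList] using ih l

/-- Truth values and the unary numbers 0, 1 share an encoding, so bits can be summed and tested as
numbers. -/
theorem Val.ofBool_eq (b : Bool) : Val.ofBool b = Val.ofUnary b.toNat := by cases b <;> rfl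

theorem PolyTime.getElem {ι γ : Type*} {e : ι → Val} {N : ι → ℕ} {enc : γ → Val}
    {l : ι → List γ} (hl : PolyTime e fun i => Val.ofList enc (l i)) (hN : PolyNat e N) :
    PolyTime e fun i => ((l i)[N i]?).elim .leaf enc := by
  convert (hl.drop hN).head using 2 with i
  rw [Val.iterate_tail_ofList]
  rcases lt_or_ge (N i) (l i).length with h | h
  · rw [List.drop_eq_getElem_cons h]
    simp [Val.ofList, Val.head, h]
  · simp [List.drop_eq_nil_of_le h, Val.ofList, Val.head, h]

/-! ### Arithmetic on unary numbers -/

namespace PolyNat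
variable {ι : Type*} {e : ι → Val} {f g : ι → ℕ}

theorem const (e : ι → Val) (n : ℕ) : PolyNat e fun _ => n := PolyTime.const e _

theorem weaken {N : ι → ℕ} (hf : PolyNat e f) : PolyNat (Val.extend e N) fun x => f x.1 :=
  PolyTime.weaken hf

theorem ite {c : ι → ℕ} (hc : PolyNat e c) (hf : PolyNat e f) (hg : PolyNat e g) :
    PolyNat e fun i => if c i = 0 then g i else f i := by
  unfold PolyNat at *
  convert PolyTime.ite hc hf hg using 2 with i
  beta_reduce
  split <;> rfl

theorem sub (hf : PolyNat e f) (hg : PolyNat e g) : PolyNat e fun i => f i - g i := by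
  unfold PolyNat at *
  convert PolyTime.drop hg hf using 2 with i
  rw [Val.iterate_tail_ofUnary]

theorem add (hf : PolyNat e f) (hg : PolyNat e g) : PolyNat e fun i => f i + g i := by
  have := PolyTime.bounded (s := fun i j => Val.ofUnary (f i - j + g i)) hf
    (by simpa [PolyNat] using hg) ?_ ?_
  · simpa [PolyNat] using this
  · have h0 := PolyTime.refl fun x : (i : ι) × Fin (f i) => Val.node (Val.extend e f x)
      (Val.ofUnary (f x.1 - (x.2 + 1) + g x.1))
    convert (PolyTime.leaf _).pair h0.right using 2 with x
    have : f x.1 - x.2 + g x.1 = f x.1 - (x.2 + 1) + g x.1 + 1 := by omega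
    rw [this]
    rfl
  · obtain ⟨P, hP⟩ := hf.le
    obtain ⟨Q, hQ⟩ := hg.le
    refine ⟨2 * (P + Q) + 1, fun i j _ => ?_⟩
    have := hP i
    have := hQ i
    simp [Val.size_ofUnary]
    omega

theorem sum {N : ι → ℕ} {f : ι → ℕ → ℕ} (hN : PolyNat e N)
    (hf : PolyNat (Val.extend e N) fun x => f x.1 x.2) :
    PolyNat e fun i => ∑ j ∈ Finset.range (N i), f i j := by
  have := PolyTime.bounded (s := fun i j => Val.ofUnary (∑ x ∈ Finset.Ico j (N i), f i x)) hN
    (by simpa [PolyNat] using PolyNat.const e 0) ?_ ?_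
  · simpa [PolyNat] using this
  · have h0 := PolyTime.refl fun x : (i : ι) × Fin (N i) => Val.node (Val.extend e N x)
      (Val.ofUnary (∑ y ∈ Finset.Ico (x.2 + 1 : ℕ) (N x.1), f x.1 y))
    have h1 : PolyNat (fun x : (i : ι) × Fin (N i) => Val.node (Val.extend e N x)
      (Val.ofUnary (∑ y ∈ Finset.Ico (x.2 + 1 : ℕ) (N x.1), f x.1 y))) fun x => f x.1 x.2 :=
      h0.left.trans hf
    have h2 := h1.add h0.right
    unfold PolyNat at h2
    convert h2 using 3 with x
    exact Finset.sum_eq_sum_Ico_succ_bot x.2.2 _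
  · obtain ⟨P, hP⟩ := hN.le
    obtain ⟨Q, hQ⟩ := hf.le
    refine ⟨2 * (P * (Q.comp (2 * P + .X + 2))) + 1, fun i j _ => ?_⟩
    have : ∑ x ∈ Finset.Ico j (N i), f i x ≤
        (Finset.Ico j (N i)).card • Q.eval (2 * P.eval (e i).size + (e i).size + 2) := by
      refine Finset.sum_le_card_nsmul _ _ _ fun x hx => ?_
      refine (hQ ⟨i, x, (Finset.mem_Ico.1 hx).2⟩).trans (Q.eval_nat_mono ?_)
      have := hP i
      have := (Finset.mem_Ico.1 hx).2
      simp only [Val.extend, Val.size, Val.size_ofUnary]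
      omega
    simp only [Nat.card_Ico, smul_eq_mul] at this
    have h2 : (N i - j) * Q.eval (2 * P.eval (e i).size + (e i).size + 2) ≤
        P.eval (e i).size * Q.eval (2 * P.eval (e i).size + (e i).size + 2) :=
      Nat.mul_le_mul_right _ ((Nat.sub_le _ _).trans (hP i))
    simp [Val.size_ofUnary, Polynomial.eval_comp]
    omega

theorem mul (hf : PolyNat e f) (hg : PolyNat e g) : PolyNat e fun i => f i * g i := by
  simpa using sum hf (f := fun i _ => g i) hg.weaken

theorem eval (P : Polynomial ℕ) (hf : PolyNat e f) : PolyNat e fun i => P.eval (f i) := by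
  induction P using Polynomial.induction_on' with
  | add p q hp hq => simpa using hp.add hq
  | monomial n a =>
    induction n with
    | zero => simpa using const e a
    | succ n ih =>
      convert ih.mul hf using 2 with i
      simp [pow_succ, mul_assoc]

/-- A truth value, as the number `0` or `1`. -/
theorem le_indicator (hf : PolyNat e f) (hg : PolyNat e g) :
    PolyNat e fun i => if f i ≤ g i then 1 else 0 := by
  convert ite (hf.sub hg) (const e 0) (const e 1) using 3 with i
  simp [Nat.sub_eq_zero_iff_le]

/-- The quotient is the number of `j < f` with `(j + 1) * g ≤ f`. -/
theorem div (hf : PolyNat e f) (hg : PolyNat e g) (h0 : ∀ i, 0 < g i) :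
    PolyNat e fun i => f i / g i := by
  have h1 : PolyNat (Val.extend e f) fun x => if ((x.2 : ℕ) + 1) * g x.1 ≤ f x.1 then 1 else 0 :=
    le_indicator ((PolyTime.var.add (const _ 1)).mul hg.weaken) hf.weaken
  convert sum hf (f := fun i j => if (j + 1) * g i ≤ f i then 1 else 0) h1 using 2 with i
  have : (Finset.range (f i)).filter (fun j => (j + 1) * g i ≤ f i) =
      Finset.range (f i / g i) := by
    ext j
    simp only [Finset.mem_filter, Finset.mem_range]
    rw [← Nat.le_div_iff_mul_le (h0 i)]
    have := Nat.div_le_self (f i) (g i)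
    omega
  rw [Finset.sum_boole, this]
  simp

theorem mod (hf : PolyNat e f) (hg : PolyNat e g) (h0 : ∀ i, 0 < g i) :
    PolyNat e fun i => f i % g i := by
  convert hf.sub (hg.mul (hf.div hg h0)) using 2 with i
  have := Nat.mod_add_div (f i) (g i)
  omega

end PolyNat

/-- The number of iterations is not known beforehand, so the remaining list itself serves as loop
test while the second component counts. -/
theorem PolyTime.length {ι : Type*} {γ : ι → Type*} {e : ι → Val} {enc : ∀ i, γ i → Val}
    {l : ∀ i, List (γ i)} (hl : PolyTime e fun i => Val.ofList (enc i) (l i)) :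
    PolyNat e fun i => (l i).length := by
  have hsize : ∀ i (l : List (γ i)), l.length ≤ (Val.ofList (enc i) l).size := by
    intro i l
    induction l with
    | nil => simp
    | cons a l ih => simp only [Val.ofList, Val.size, List.length_cons]; omega
  obtain ⟨Q, hQ⟩ := hl.size_le
  have hdrop : ∀ i (l : List (γ i)) m,
      (Val.ofList (enc i) (l.drop m)).size ≤ (Val.ofList (enc i) l).size := by
    intro i l m
    rw [← Val.iterate_tail_ofList]
    induction m with
    | zero => simp
    | succ m ih =>
      rw [Function.iterate_succ_apply']
      exact (Val.size_tail_le _).trans ih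
  have := PolyTime.loop (e := e) (N := fun i => (l i).length)
    (V := fun i j => .node (Val.ofList (enc i) ((l i).drop ((l i).length - j)))
      (Val.ofUnary ((l i).length - j)))
    (c := fun i j => Val.ofList (enc i) ((l i).drop ((l i).length - j)))
    (by simpa using hl.pair (PolyNat.const e 0)) (PolyTime.left (PolyTime.refl _))
    (by simp [Val.ofList]) ?_ ?_ ?_ ?_
  · simpa [PolyNat] using this.right
  · intro i j hj
    rw [List.drop_eq_getElem_cons (by omega)]
    simp [Val.ofList]
  · have h0 := PolyTime.refl fun x : (i : ι) × Fin (l i).length =>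
      Val.node (Val.ofList (enc x.1) ((l x.1).drop ((l x.1).length - (x.2 + 1))))
      (Val.ofUnary ((l x.1).length - (x.2 + 1)))
    convert (h0.left.tail).pair ((PolyTime.leaf _).pair h0.right) using 3 with x
    · have h2 := Val.iterate_tail_ofList (enc x.1) 1 ((l x.1).drop ((l x.1).length - (x.2 + 1)))
      rw [Function.iterate_one, List.drop_drop] at h2
      rw [h2]
      congr 2
      omega
    · have : (l x.1).length - x.2 = (l x.1).length - (x.2 + 1) + 1 := by omega
      rw [this]
      rfl
  · exact ⟨Q, fun i => (hsize _ _).trans (hQ i)⟩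
  · refine ⟨Q + 2 * Q + 2, fun i j _ => ?_⟩
    have h1 := (hsize i (l i)).trans (hQ i)
    have h2 := (hdrop i (l i) ((l i).length - j)).trans (hQ i)
    simp [Val.size, Val.size_ofUnary]
    omega

theorem Val.ofList_map {γ γ' : Type*} (enc : γ' → Val) (f : γ → γ') (l : List γ) :
    Val.ofList enc (l.map f) = Val.ofList (fun x => enc (f x)) l := by
  induction l with
  | nil => rfl
  | cons a l ih => simp [Val.ofList, ih]

/-! ### Tables and sums indexed by dependent finite types -/

section Finite
variable {ι : Type*} {e : ι → Val} {N : ι → ℕ}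

theorem PolyTime.tabulate_ofFn {γ : ι → Type*} {enc : ∀ i, γ i → Val} {g : ∀ i, Fin (N i) → γ i}
    (hN : PolyNat e N) (hg : PolyTime (Val.extend e N) fun x => enc x.1 (g x.1 x.2)) :
    PolyTime e fun i => Val.ofList (enc i) (List.ofFn (g i)) := by
  have := PolyTime.tabulate (f := fun i j => if h : j < N i then enc i (g i ⟨j, h⟩) else .leaf) hN
    (by simpa using hg)
  convert this using 2 with i
  have h1 : List.range (N i) = (List.finRange (N i)).map Fin.val := by simp
  rw [h1, Val.ofList_map, List.ofFn_eq_map, Val.ofList_map]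
  simp

theorem PolyTime.tabulate_finRange {f : (x : (i : ι) × Fin (N i)) → Val}
    (hN : PolyNat e N) (hf : PolyTime (Val.extend e N) f) :
    PolyTime e fun i => Val.ofList (fun j => f ⟨i, j⟩) (List.finRange (N i)) := by
  simpa [List.ofFn_id] using PolyTime.tabulate_ofFn (enc := fun i j => f ⟨i, j⟩)
    (g := fun i => (id : Fin (N i) → Fin (N i))) hN hf

theorem PolyNat.sum_fin {f : (x : (i : ι) × Fin (N i)) → ℕ} (hN : PolyNat e N)
    (hf : PolyNat (Val.extend e N) f) : PolyNat e fun i => ∑ j, f ⟨i, j⟩ := by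
  have := PolyNat.sum (f := fun i j => if h : j < N i then f ⟨i, j, h⟩ else 0) hN
    (by simpa using hf)
  convert this using 2 with i
  rw [Finset.sum_range]
  simp

end Finite

/-! ### The distinguisher obtained from a learner -/

open Classical in
/-- The adjacency matrix of a graph, extended by zero. -/
noncomputable def SimpleGraph.adjNat {n : ℕ} (G : SimpleGraph (Fin n)) (u v : ℕ) : ℕ :=
  if ∃ (hu : u < n) (hv : v < n), G.Adj ⟨u, hu⟩ ⟨v, hv⟩ then 1 else 0

theorem SimpleGraph.adjNat_le_one {n : ℕ} (G : SimpleGraph (Fin n)) (u v : ℕ) :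
    G.adjNat u v ≤ 1 := by
  unfold SimpleGraph.adjNat
  split <;> simp

section
variable {ι : Type*} {e : ι → Val}

/-- Two list lookups. A lookup out of range returns a leaf, which encodes 0, in agreement with the
extension of the matrix by zero. -/
theorem PolyNat.adjNat {n : ι → ℕ} {G : ∀ i, SimpleGraph (Fin (n i))} {u v : ι → ℕ}
    (hG : PolyTime e fun i => Val.ofGraph (G i)) (hu : PolyNat e u) (hv : PolyNat e v) :
    PolyNat e fun i => (G i).adjNat (u i) (v i) := by
  classical
  let row : (i : ι) → Fin (n i) → List Bool :=
    fun i u => (List.finRange (n i)).map fun v => decide ((G i).Adj u v)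
  have h1 : PolyTime e fun i =>
      Val.ofList (Val.ofList Val.ofBool) ((List.finRange (n i)).map (row i)) := by
    convert hG using 2 with i
    simp only [Val.ofGraph, Val.ofList_map, row]
  have h2 := h1.getElem hu
  have h3 : PolyTime e fun i =>
      Val.ofList Val.ofBool ((((List.finRange (n i)).map (row i))[u i]?).getD []) := by
    convert h2 using 2 with i
    cases ((List.finRange (n i)).map (row i))[u i]? <;> rfl
  have h4 := h3.getElem hv
  unfold PolyNat
  convert h4 using 2 with i
  by_cases h5 : u i < n i
  · by_cases h6 : v i < n i
    · simp only [SimpleGraph.adjNat, h5, h6, List.getElem?_map, row, exists_true_left, Val.ofBool_eq,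
        List.getElem?_eq_getElem, List.length_finRange, List.getElem_finRange, Option.map_some,
        Option.getD_some, Option.elim_some]
      by_cases h7 : (G i).Adj ⟨u i, h5⟩ ⟨v i, h6⟩ <;> simp [h7]
    · simp [SimpleGraph.adjNat, h5, h6, row, Val.ofUnary]
  · simp [SimpleGraph.adjNat, h5, Val.ofUnary]

end

/-- The game in which the items are `2 m` disjoint blocks of vertices of equal size, and the labels
of a block are its vertices. -/
def blockGame (n m : ℕ) (h : 0 < m ∧ 2 * m ≤ n) : GameSize where
  scale := n
  items := 2 * m
  labels := n / (2 * m)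
  rounds := m * m
  labels_pos := Nat.div_pos h.2 (by omega)

/-- Round `t` asks for an edge between the blocks `t / m` and `m + t % m`. -/
noncomputable def edgeRound {n : ℕ} (G : SimpleGraph (Fin n)) (m : ℕ) (h : 0 < m ∧ 2 * m ≤ n)
    (t : Fin (m * m)) : Round (2 * m) (n / (2 * m)) where
  fst := ⟨t / m, by have := Nat.div_lt_of_lt_mul t.2; omega⟩
  snd := ⟨m + t % m, by have := Nat.mod_lt t h.1; omega⟩
  distinct := by
    have := Nat.div_lt_of_lt_mul t.2
    simp only [ne_eq, Fin.mk.injEq]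
    omega
  payoff a b := G.adjNat (t / m * (n / (2 * m)) + a) ((m + t % m) * (n / (2 * m)) + b)
  bounded a b := by
    have := G.adjNat_le_one (t / m * (n / (2 * m)) + a) ((m + t % m) * (n / (2 * m)) + b)
    rw [abs_of_nonneg (by positivity)]
    exact_mod_cast this

namespace Learner
variable (A : Learner)

/-- The number of coins that the learner uses in `blockGame n m`. -/
noncomputable def blockCoins (n m : ℕ) : ℕ := A.coins.eval (n + 2 * m + n / (2 * m) + m * m)

/-- The labels that the learner chooses in round `t`. -/
noncomputable def answer {n : ℕ} (G : SimpleGraph (Fin n)) (m : ℕ) (h : 0 < m ∧ 2 * m ≤ n)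
    (r : Fin (A.blockCoins n m) → Bool) (t : Fin (m * m)) :
    Fin (n / (2 * m)) × Fin (n / (2 * m)) :=
  A.predict (blockGame n m h) r ((List.ofFn (edgeRound G m h)).take t)
    ((edgeRound G m h t).fst, (edgeRound G m h t).snd)

/-- The payoff of the learner in round `t`. -/
noncomputable def gain {n : ℕ} (G : SimpleGraph (Fin n)) (m : ℕ) (h : 0 < m ∧ 2 * m ≤ n)
    (r : Fin (A.blockCoins n m) → Bool) (t : Fin (m * m)) : ℕ :=
  G.adjNat (t / m * (n / (2 * m)) + (A.answer G m h r t).1)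
    ((m + t % m) * (n / (2 * m)) + (A.answer G m h r t).2)

end Learner

section
variable {ι : Type*} {e : ι → Val}

/-- Payoffs are only 0 or 1, so encoding them as rationals is a case distinction between two
constants. -/
theorem PolyTime.ofRat_adjNat {f : ι → ℕ} (hf : PolyNat e f) (hle : ∀ i, f i ≤ 1) :
    PolyTime e fun i => Val.ofRat (f i) := by
  convert PolyTime.ite hf (const e (Val.ofRat 1)) (const e (Val.ofRat 0)) using 2 with i
  have := hle i
  interval_cases f i <;> simp

theorem PolyTime.ofRound_edgeRound {n m t : ι → ℕ} {G : ∀ i, SimpleGraph (Fin (n i))}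
    (h : ∀ i, 0 < m i ∧ 2 * m i ≤ n i) (ht : ∀ i, t i < m i * m i)
    (hn : PolyNat e n) (hm : PolyNat e m) (htp : PolyNat e t)
    (hG : PolyTime e fun i => Val.ofGraph (G i)) :
    PolyTime e fun i => Val.ofRound (edgeRound (G i) (m i) (h i) ⟨t i, ht i⟩) := by
  have hL : PolyNat e fun i => n i / (2 * m i) :=
    hn.div ((PolyNat.const e 2).mul hm) fun i => by have := h i; omega
  have h1 := htp.div hm fun i => (h i).1
  have h2 := hm.add (htp.mod hm fun i => (h i).1)
  refine (h1.pair h2).pair (tabulate_finRange (f := fun x : (i : ι) × Fin (n i / (2 * m i)) =>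
    Val.ofList
      (fun b => Val.ofRat ((edgeRound (G x.1) (m x.1) (h x.1) ⟨t x.1, ht x.1⟩).payoff x.2 b))
      (List.finRange (n x.1 / (2 * m x.1)))) hL ?_)
  refine tabulate_finRange (f := fun x : (i : (i : ι) × Fin (n i / (2 * m i))) ×
    Fin (n i.1 / (2 * m i.1)) => Val.ofRat
      ((edgeRound (G x.1.1) (m x.1.1) (h x.1.1) ⟨t x.1.1, ht x.1.1⟩).payoff x.1.2 x.2))
      hL.weaken ?_
  refine ofRat_adjNat (PolyNat.adjNat hG.weaken.weaken ?_ ?_) fun x =>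
    SimpleGraph.adjNat_le_one _ _ _
  · exact (h1.mul hL).weaken.weaken.add (PolyNat.weaken var)
  · exact (h2.mul hL).weaken.weaken.add var

/-- The whole input of the learner in round `t` is rebuilt from the graph and the coins; as the
payoffs do not depend on its answers, no earlier round has to be simulated. -/
theorem PolyNat.gain (A : Learner) {n m t : ι → ℕ} {G : ∀ i, SimpleGraph (Fin (n i))}
    (h : ∀ i, 0 < m i ∧ 2 * m i ≤ n i) (ht : ∀ i, t i < m i * m i)
    {r : ∀ i, Fin (A.blockCoins (n i) (m i)) → Bool}
    (hn : PolyNat e n) (hm : PolyNat e m) (htp : PolyNat e t)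
    (hG : PolyTime e fun i => Val.ofGraph (G i)) (hr : PolyTime e fun i => Val.ofCoins (r i)) :
    PolyNat e fun i => A.gain (G i) (m i) (h i) (r i) ⟨t i, ht i⟩ := by
  have hL : PolyNat e fun i => n i / (2 * m i) :=
    hn.div ((PolyNat.const e 2).mul hm) fun i => by have := h i; omega
  have h1 := htp.div hm fun i => (h i).1
  have h2 := hm.add (htp.mod hm fun i => (h i).1)
  have hpast : PolyTime e fun i =>
      Val.ofList Val.ofRound ((List.ofFn (edgeRound (G i) (m i) (h i))).take (t i)) := by
    have := PolyTime.tabulate_ofFn (enc := fun i => Val.ofRound)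
      (g := fun i (s : Fin (t i)) => edgeRound (G i) (m i) (h i) ⟨s, s.2.trans (ht i)⟩) htp
      (PolyTime.ofRound_edgeRound (fun x => h x.1) (fun x => x.2.2.trans (ht x.1)) hn.weaken
        hm.weaken PolyTime.var hG.weaken)
    convert this using 3 with i
    refine List.ext_getElem ?_ ?_
    · simpa using (ht i).le
    · simp
  have hin : PolyTime e fun i => learnerInput (blockGame (n i) (m i) (h i)) (r i)
      ((List.ofFn (edgeRound (G i) (m i) (h i))).take (t i))
      ((edgeRound (G i) (m i) (h i) ⟨t i, ht i⟩).fst,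
        (edgeRound (G i) (m i) (h i) ⟨t i, ht i⟩).snd) :=
    (hn.pair (((PolyNat.const e 2).mul hm).pair (hL.pair (hm.mul hm)))).pair
      (hr.pair (hpast.pair (h1.pair h2)))
  have hout := hin.trans (g := fun i => Val.ofPair (A.answer (G i) (m i) (h i) (r i) ⟨t i, ht i⟩))
    ⟨A.prog, A.time, fun i => A.runs (blockGame (n i) (m i) (h i)) (r i)
      ((List.ofFn (edgeRound (G i) (m i) (h i))).take (t i))
      ((edgeRound (G i) (m i) (h i) ⟨t i, ht i⟩).fst,
        (edgeRound (G i) (m i) (h i) ⟨t i, ht i⟩).snd)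
      (by simp [blockGame, ht i]) (edgeRound (G i) (m i) (h i) ⟨t i, ht i⟩).distinct⟩
  exact PolyNat.adjNat hG ((h1.mul hL).add hout.left) ((h2.mul hL).add hout.right)

end

/-- The `i`-th block of `c` coins, padded by `false`. -/
def coinBlock {Q : ℕ} (r : Fin Q → Bool) (c i : ℕ) (j : Fin c) : Bool :=
  if h : i * c + j < Q then r ⟨i * c + j, h⟩ else false

theorem PolyTime.coinBlock {ι : Type*} {e : ι → Val} {Q c k : ι → ℕ} {r : ∀ i, Fin (Q i) → Bool}
    (hr : PolyTime e fun i => Val.ofCoins (r i)) (hc : PolyNat e c) (hk : PolyNat e k) :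
    PolyTime e fun i => Val.ofCoins (coinBlock (r i) (c i) (k i)) := by
  refine PolyTime.tabulate_ofFn (enc := fun _ => Val.ofBool)
    (g := fun i => _root_.coinBlock (r i) (c i) (k i)) hc ?_
  convert hr.weaken.getElem ((hk.mul hc).weaken.add PolyTime.var) using 2 with x
  by_cases h : k x.1 * c x.1 + x.2 < Q x.1
  · simp [_root_.coinBlock, h]
  · simp [_root_.coinBlock, h, Val.ofBool]

namespace Learner
variable (A : Learner)

/-- The total payoff of the learner in `n` independent games of parameter `m`. -/
noncomputable def totalGain {n Q : ℕ} (G : SimpleGraph (Fin n)) (m : ℕ) (h : 0 < m ∧ 2 * m ≤ n)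
    (r : Fin Q → Bool) : ℕ :=
  ∑ i : Fin n, ∑ t, A.gain G m h (coinBlock r (A.blockCoins n m) i) t

/-- Twice the number of edges. -/
noncomputable def _root_.SimpleGraph.adjSum {n : ℕ} (G : SimpleGraph (Fin n)) : ℕ :=
  ∑ u : Fin n, ∑ v : Fin n, G.adjNat u v

/-- The mean payoff of the learner exceeds the multiple `16` of what the edge density suggests, by
a margin `3 m`. -/
def Exceeds {n Q : ℕ} (G : SimpleGraph (Fin n)) (r : Fin Q → Bool) (x : Fin (n / 2)) : Prop :=
  -- With `m = x + 1` every `m` such that `0 < m` and `2 * m ≤ n` is covered. The comparison is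
  -- multiplied by `n * n` to stay among natural numbers.
  16 * G.adjSum * ((x + 1) * (x + 1)) + 3 * (x + 1) * (n * n) ≤
    n * A.totalGain G (x + 1) (by omega) r

/-- The search over all `m` uses nothing but the graph and the coins, so the sequences `k`, `p`, `q`
need not be computable. -/
theorem polyTime_exceeds {ι : Type*} {e : ι → Val} {n Q : ι → ℕ} {G : ∀ i, SimpleGraph (Fin (n i))}
    {r : ∀ i, Fin (Q i) → Bool} (hG : PolyTime e fun i => Val.ofGraph (G i))
    (hr : PolyTime e fun i => Val.ofCoins (r i)) :
    open Classical in
    PolyTime e fun i => Val.ofBool (decide (∃ x, A.Exceeds (G i) (r i) x)) := by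
  classical
  have hn : PolyNat e n := by
    unfold Val.ofGraph at hG
    simpa using hG.length
  have hdeg : PolyNat e fun i => (G i).adjSum := by
    refine PolyNat.sum_fin (f := fun x : (i : ι) × Fin (n i) =>
      ∑ v : Fin (n x.1), (G x.1).adjNat x.2 v) hn ?_
    refine PolyNat.sum_fin (f := fun x : (x : (i : ι) × Fin (n i)) × Fin (n x.1) =>
      (G x.1.1).adjNat x.1.2 x.2) hn.weaken ?_
    exact PolyNat.adjNat hG.weaken.weaken (PolyNat.weaken PolyTime.var) PolyTime.var
  have hm : PolyNat (Val.extend e fun i => n i / 2) fun x => (x.2 : ℕ) + 1 :=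
    PolyNat.add PolyTime.var (PolyNat.const _ 1)
  have hL : PolyNat (Val.extend e fun i => n i / 2) fun x => n x.1 / (2 * ((x.2 : ℕ) + 1)) :=
    hn.weaken.div ((PolyNat.const _ 2).mul hm) fun x => by omega
  have hc : PolyNat (Val.extend e fun i => n i / 2) fun x => A.blockCoins (n x.1) (x.2 + 1) :=
    (((hn.weaken.add ((PolyNat.const _ 2).mul hm)).add hL).add (hm.mul hm)).eval _
  have htot : PolyNat (Val.extend e fun i => n i / 2)
      fun x => A.totalGain (G x.1) (x.2 + 1) (by omega) (r x.1) := by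
    refine PolyNat.sum_fin (N := fun x : (i : ι) × Fin (n i / 2) => n x.1) (f := fun y =>
      ∑ t, A.gain (G y.1.1) (y.1.2 + 1) (by omega) (coinBlock (r y.1.1) (A.blockCoins (n y.1.1) (y.1.2 + 1)) y.2) t) hn.weaken ?_
    refine PolyNat.sum_fin (N := fun y : (x : (i : ι) × Fin (n i / 2)) × Fin (n x.1) =>
      (y.1.2 + 1) * (y.1.2 + 1)) (f := fun z =>
      A.gain (G z.1.1.1) (z.1.1.2 + 1)
      (by omega) (coinBlock (r z.1.1.1) (A.blockCoins (n z.1.1.1) (z.1.1.2 + 1)) z.1.2) z.2)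
      (hm.mul hm).weaken ?_
    exact PolyNat.gain A (fun z => by omega) (fun z => z.2.2) hn.weaken.weaken.weaken
      hm.weaken.weaken PolyTime.var hG.weaken.weaken.weaken
      (hr.weaken.weaken.weaken.coinBlock hc.weaken.weaken (PolyNat.weaken PolyTime.var))
  have hind : PolyNat (Val.extend e fun i => n i / 2)
      fun x => if A.Exceeds (G x.1) (r x.1) x.2 then 1 else 0 := by
    convert PolyNat.le_indicator ((((PolyNat.const _ 16).mul hdeg.weaken).mul (hm.mul hm)).add
      (((PolyNat.const _ 3).mul hm).mul (hn.mul hn).weaken)) (hn.weaken.mul htot) using 3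
    exact Iff.rfl
  -- The existential is decided by testing whether the number of witnesses is zero.
  have hsum := PolyNat.sum_fin (hn.div (PolyNat.const e 2) (by simp)) hind
  have := PolyNat.ite hsum (PolyNat.const e 1) (PolyNat.const e 0)
  unfold PolyNat at this
  convert this using 2 with i
  rw [Val.ofBool_eq]
  congr 1
  by_cases hx : ∃ x, A.Exceeds (G i) (r i) x
  · have : ∑ j, (if A.Exceeds (G i) (r i) j then 1 else 0) ≠ 0 := by
      rw [Finset.sum_boole]
      simpa [Finset.filter_eq_empty_iff] using hx
    simp [hx]
  · simp only [not_exists] at hx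
    simp [hx]

theorem _root_.Val.size_ofBool_le (b : Bool) : (Val.ofBool b).size ≤ 3 := by
  cases b <;> simp [Val.ofBool, Val.size]

theorem _root_.Val.size_ofGraph_le {n : ℕ} (G : SimpleGraph (Fin n)) :
    (Val.ofGraph G).size ≤ n * (n * 4 + 2) + 1 := by
  refine (Val.size_ofList_le (B := n * 4 + 1) _ _ fun u _ => ?_).trans (by simp)
  exact (Val.size_ofList_le (B := 3) _ _ fun v _ => Val.size_ofBool_le _).trans (by simp)

theorem _root_.Val.size_ofCoins_le {m : ℕ} (r : Fin m → Bool) :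
    (Val.ofCoins r).size ≤ m * 4 + 1 :=
  (Val.size_ofList_le (B := 3) _ _ fun v _ => Val.size_ofBool_le _).trans (by simp)

/-- The number of coins of the distinguisher. -/
noncomputable def distinguisherCoins : Polynomial ℕ := .X * A.coins.comp (.X ^ 2 + 3 * .X)

theorem exists_distinguisher : open Classical in
    ∃ D : Distinguisher, D.coins = A.distinguisherCoins ∧
      ∀ n (G : SimpleGraph (Fin n)) r, D.verdict n G r = decide (∃ x, A.Exceeds G r x) := by
  classical
  obtain ⟨F, P, hF⟩ := A.polyTime_exceeds
    (ι := (n : ℕ) × SimpleGraph (Fin n) × (Fin (A.distinguisherCoins.eval n) → Bool))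
    (e := fun i => .node (Val.ofGraph i.2.1) (Val.ofCoins i.2.2)) (n := fun i => i.1)
    (Q := fun i => A.distinguisherCoins.eval i.1) (G := fun i => i.2.1) (r := fun i => i.2.2)
    (PolyTime.refl _).left (PolyTime.refl _).right
  refine ⟨⟨F, A.distinguisherCoins,
    P.comp (.X * (.X * 4 + 2) + 1 + (A.distinguisherCoins * 4 + 1) + 1),
    fun n G r => decide (∃ x, A.Exceeds G r x), fun n G r => ?_⟩, rfl, fun n G r => rfl⟩
  obtain ⟨t, ht, hr⟩ := hF ⟨n, G, r⟩
  refine ⟨t, ht.trans ?_, hr⟩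
  simp only [Polynomial.eval_comp]
  refine P.eval_nat_mono ?_
  have h1 := Val.size_ofGraph_le G
  have h2 := Val.size_ofCoins_le r
  simp [Val.size]
  omega

end Learner

/-! ### Binomial random graphs on a finite vertex set -/

namespace SimpleGraph

instance {V : Type*} [Countable V] : MeasurableSingletonClass (SimpleGraph V) where
  measurableSet_singleton G := by
    have : ({G} : Set (SimpleGraph V)) = edgeSet ⁻¹' {G.edgeSet} := by
      ext H
      simp
    rw [this]
    exact measurable_edgeSet (measurableSet_singleton _)

variable {n : ℕ} {p : unitInterval}

open Classical in
theorem adjNat_fin (G : SimpleGraph (Fin n)) (u v : Fin n) :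
    G.adjNat u v = if G.Adj u v then 1 else 0 := by
  simp [adjNat]

/-- Adding an edge trades a factor `1 - p` for a factor `p`. The form without division covers `p =
0` and `p = 1`. -/
theorem measureReal_sup_edge {G : SimpleGraph (Fin n)} {u v : Fin n} (huv : u ≠ v)
    (hG : ¬ G.Adj u v) :
    (binomialRandom (Fin n) p).real {G ⊔ edge u v} * (1 - p) =
      (binomialRandom (Fin n) p).real {G} * p := by
  classical
  have h1 : (G ⊔ edge u v).edgeSet.ncard = G.edgeSet.ncard + 1 := by
    rw [edgeSet_sup, edgeSet_edge_of_ne huv, Set.union_singleton,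
      Set.ncard_insert_of_notMem (by simpa using hG)]
  have h2 : (G ⊔ edge u v).edgeSet.ncard ≤ n.choose 2 := by
    have := (G ⊔ edge u v).card_edgeFinset_le_card_choose_two
    rwa [← Set.ncard_coe_finset, coe_edgeFinset, Fintype.card_fin] at this
  simp only [measureReal_def, binomialRandom_singleton, ENNReal.toReal_mul, ENNReal.toReal_pow,
    ENNReal.coe_toReal, unitInterval.coe_toNNReal, unitInterval.coe_symm_eq,
    Nat.card_eq_fintype_card, Fintype.card_fin]
  rw [h1] at h2 ⊢
  have h3 : n.choose 2 - G.edgeSet.ncard = n.choose 2 - (G.edgeSet.ncard + 1) + 1 := by omega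
  rw [h3]
  ring

/-- The event that `u` and `v` are adjacent is independent of all other adjacencies. -/
theorem integral_mul_adj {u v : Fin n} (huv : u ≠ v) (f : SimpleGraph (Fin n) → ℝ)
    (hf : ∀ G, f (G ⊔ edge u v) = f G) :
    ∫ G, f G * G.adjNat u v ∂binomialRandom (Fin n) p =
      p * ∫ G, f G ∂binomialRandom (Fin n) p := by
  classical
  rw [← integral_const_mul, ← sub_eq_zero, ← integral_sub .of_finite .of_finite,
    integral_fintype .of_finite]
  -- Toggling the edge `uv` is an involution without fixed points that preserves `f`; the two terms
  -- of each orbit cancel by `measureReal_sup_edge`.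
  refine Finset.sum_involution (fun G _ => if G.Adj u v then G \ edge u v else G ⊔ edge u v)
    ?_ ?_ (by simp) ?_
  · intro G _
    by_cases hG : G.Adj u v
    · have h1 : ¬ (G \ edge u v).Adj u v := by simp [edge_adj, huv]
      have h2 : G \ edge u v ⊔ edge u v = G := by
        rw [sdiff_sup_self, sup_eq_left, edge_le_iff]
        exact Or.inr hG
      have h3 := measureReal_sup_edge (p := p) huv h1
      have h4 := hf (G \ edge u v)
      rw [h2] at h3 h4
      simp only [hG, if_true, adjNat_fin, h1, if_false, smul_eq_mul, ← h4]
      linear_combination f G * h3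
    · have h1 : (G ⊔ edge u v).Adj u v := by simp [edge_adj, huv]
      have h3 := measureReal_sup_edge (p := p) huv hG
      simp only [hG, if_true, adjNat_fin, h1, if_false, smul_eq_mul, hf G]
      linear_combination f G * h3
  · intro G _ _ h
    by_cases hG : G.Adj u v
    · have h1 : ¬ (G \ edge u v).Adj u v := by simp [edge_adj, huv]
      simp only [hG, if_true] at h
      rw [h] at h1
      exact h1 hG
    · have h1 : (G ⊔ edge u v).Adj u v := by simp [edge_adj, huv]
      simp only [hG, if_false] at h
      rw [h] at h1
      exact hG h1
  · intro G _
    by_cases hG : G.Adj u v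
    · have h1 : ¬ (G \ edge u v).Adj u v := by simp [edge_adj, huv]
      simp only [hG, h1, if_true, if_false]
      rw [sdiff_sup_self, sup_eq_left, edge_le_iff]
      exact Or.inr hG
    · have h1 : (G ⊔ edge u v).Adj u v := by simp [edge_adj, huv]
      simp only [hG, h1, if_true, if_false]
      rw [sup_sdiff_right_self, sdiff_edge _ hG]

/-- As the adjacency is 0 or 1, the exponential is an affine function of it, which reduces the claim
to `integral_mul_adj`. -/
theorem integral_mul_exp_adj {u v : Fin n} (huv : u ≠ v) (f : SimpleGraph (Fin n) → ℝ)
    (hf : ∀ G, f (G ⊔ edge u v) = f G) (c : ℝ) :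
    ∫ G, f G * Real.exp (c * G.adjNat u v) ∂binomialRandom (Fin n) p =
      (1 + p * (Real.exp c - 1)) * ∫ G, f G ∂binomialRandom (Fin n) p := by
  have h1 : ∀ G : SimpleGraph (Fin n), f G * Real.exp (c * G.adjNat u v) =
      f G + (Real.exp c - 1) * (f G * G.adjNat u v) := by
    intro G
    have h2 := G.adjNat_le_one u v
    interval_cases G.adjNat u v <;> simp
    ring
  simp_rw [h1]
  rw [integral_add .of_finite .of_finite, integral_const_mul, integral_mul_adj huv f hf]
  ring

theorem integral_adjNat {u v : Fin n} (huv : u ≠ v) :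
    ∫ G : SimpleGraph (Fin n), (G.adjNat u v : ℝ) ∂binomialRandom (Fin n) p = p := by
  simpa using integral_mul_adj (p := p) huv (fun _ => 1) (fun _ => rfl)

theorem adjNat_congr {G H : SimpleGraph (Fin n)} {u v : Fin n} (h : G.Adj u v ↔ H.Adj u v) :
    G.adjNat u v = H.adjNat u v := by
  rw [adjNat_fin, adjNat_fin]
  by_cases hG : G.Adj u v
  · rw [if_pos hG, if_pos (h.1 hG)]
  · rw [if_neg hG, if_neg (mt h.2 hG)]

/-- Pairs are kept in increasing order so that distinct pairs are distinct edges. -/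
theorem adjNat_sup_edge {G : SimpleGraph (Fin n)} {u v x y : Fin n} (huv : u < v) (hxy : x < y)
    (h : (x, y) ≠ (u, v)) : (G ⊔ edge u v).adjNat x y = G.adjNat x y := by
  refine adjNat_congr ?_
  simp only [sup_adj, edge_adj, or_iff_left_iff_imp]
  rintro ⟨⟨rfl, rfl⟩ | ⟨rfl, rfl⟩, _⟩
  · exact absurd rfl h
  · exact absurd hxy huv.asymm

/-! ### Exponential moments and tail bounds of edge counts -/

/-- The number of edges among a set of pairs of vertices. -/
noncomputable def countAdj (G : SimpleGraph (Fin n)) (F : Finset (Fin n × Fin n)) : ℕ :=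
  ∑ x ∈ F, G.adjNat x.1 x.2

theorem integral_exp_countAdj (F : Finset (Fin n × Fin n)) (hF : ∀ x ∈ F, x.1 < x.2) (c : ℝ) :
    ∫ G : SimpleGraph (Fin n), Real.exp (c * G.countAdj F) ∂binomialRandom (Fin n) p =
      (1 + p * (Real.exp c - 1)) ^ F.card := by
  classical
  induction F using Finset.induction_on with
  | empty => simp [countAdj]
  | insert x F hx ih =>
    have h1 : ∀ G : SimpleGraph (Fin n), Real.exp (c * G.countAdj (insert x F)) =
        Real.exp (c * G.countAdj F) * Real.exp (c * G.adjNat x.1 x.2) := by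
      intro G
      rw [countAdj, Finset.sum_insert hx, ← Real.exp_add]
      simp only [countAdj, Nat.cast_add]
      ring_nf
    simp_rw [h1]
    rw [integral_mul_exp_adj (hF x (by simp)).ne, ih fun y hy => hF y (by simp [hy]),
      Finset.card_insert_of_notMem hx, pow_succ']
    intro G
    have : (G ⊔ edge x.1 x.2).countAdj F = G.countAdj F := by
      refine Finset.sum_congr rfl fun y hy => ?_
      refine adjNat_sup_edge (hF x (by simp)) (hF y (by simp [hy])) ?_
      intro h
      obtain rfl : y = x := h
      exact hx hy
    rw [this]

/-- Chernoff bound with exponent `-1`: since `exp (-1) ≤ 1 / 2`, the exponential moment is at most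
`exp (-(p * F.card / 2))`, and Markov's inequality gives back half of the exponent. -/
theorem measureReal_countAdj_le (F : Finset (Fin n × Fin n)) (hF : ∀ x ∈ F, x.1 < x.2) :
    (binomialRandom (Fin n) p).real {G | (G.countAdj F : ℝ) ≤ p * F.card / 4} ≤
      Real.exp (-(p * F.card / 4)) := by
  have h1 := mul_meas_ge_le_integral_of_nonneg (μ := binomialRandom (Fin n) p)
    (f := fun G => Real.exp (-1 * G.countAdj F)) (.of_forall fun _ => (Real.exp_pos _).le) .of_finite
    (Real.exp (-(p * F.card / 4)))
  rw [integral_exp_countAdj F hF] at h1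
  have h2 : {G : SimpleGraph (Fin n) | (G.countAdj F : ℝ) ≤ p * F.card / 4} =
      {G | Real.exp (-(p * F.card / 4)) ≤ Real.exp (-1 * G.countAdj F)} := by
    ext G
    simp
  rw [h2]
  have h3 : (1 + p * (Real.exp (-1) - 1)) ^ F.card ≤ Real.exp (-(p * F.card / 2)) := by
    have h4 : Real.exp (-1) ≤ 1 / 2 := by
      have := Real.exp_one_gt_d9
      rw [Real.exp_neg, inv_le_comm₀ (Real.exp_pos _) (by norm_num)]
      linarith
    have h5 : 0 ≤ (p : ℝ) := p.2.1
    have h6 : (p : ℝ) ≤ 1 := p.2.2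
    have h7 : 0 < Real.exp (-1) := Real.exp_pos _
    have h8 : 1 + p * (Real.exp (-1) - 1) ≤ Real.exp (-(p / 2)) := by
      have := Real.add_one_le_exp (-((p : ℝ) / 2))
      nlinarith
    calc (1 + p * (Real.exp (-1) - 1)) ^ F.card ≤ Real.exp (-(p / 2)) ^ F.card :=
          pow_le_pow_left₀ (by nlinarith) h8 _
      _ = Real.exp (-(p * F.card / 2)) := by
          rw [← Real.exp_nat_mul]
          ring_nf
  have h4 : Real.exp (-(p * F.card / 2)) =
      Real.exp (-(p * F.card / 4)) * Real.exp (-(p * F.card / 4)) := by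
    rw [← Real.exp_add]
    ring_nf
  rw [h4] at h3
  exact le_of_mul_le_mul_left (h1.trans h3) (Real.exp_pos _)

/-- The number of edges found by adaptive queries, the `t`-th of which is chosen among the pairs
of rank `t` on the basis of the edges of lower rank, has a binomial distribution. -/
theorem integral_exp_adaptive (rank : Fin n × Fin n → ℕ)
    (f : ℕ → SimpleGraph (Fin n) → Fin n × Fin n) (T : ℕ) (hlt : ∀ t < T, ∀ G, (f t G).1 < (f t G).2)
    (hrank : ∀ t < T, ∀ G, rank (f t G) = t)
    (hadapt : ∀ t < T, ∀ G G' : SimpleGraph (Fin n),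
      (∀ x : Fin n × Fin n, x.1 < x.2 → rank x < t → G.adjNat x.1 x.2 = G'.adjNat x.1 x.2) →
      f t G = f t G') (c : ℝ) :
    ∫ G : SimpleGraph (Fin n),
      Real.exp (c * ∑ t ∈ Finset.range T, (G.adjNat (f t G).1 (f t G).2 : ℝ))
      ∂binomialRandom (Fin n) p = (1 + p * (Real.exp c - 1)) ^ T := by
  classical
  induction T with
  | zero => simp
  | succ T ih =>
    let S : SimpleGraph (Fin n) → ℝ := fun G =>
      Real.exp (c * ∑ t ∈ Finset.range T, (G.adjNat (f t G).1 (f t G).2 : ℝ))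
    -- Split according to the last query `x`. Since `x` has rank `T`, toggling it changes neither
    -- the event that `x` is asked nor the earlier outcomes, so its adjacency is independent of `g
    -- x`.
    let g : Fin n × Fin n → SimpleGraph (Fin n) → ℝ := fun x G => if f T G = x then S G else 0
    have hsum : ∀ G, ∑ x, g x G = S G := fun G => by simp [g]
    have h1 : ∀ G : SimpleGraph (Fin n),
        Real.exp (c * ∑ t ∈ Finset.range (T + 1), (G.adjNat (f t G).1 (f t G).2 : ℝ)) =
        ∑ x, g x G * Real.exp (c * G.adjNat x.1 x.2) := by
      intro G
      rw [Finset.sum_eq_single (f T G) (fun x _ hx => by simp [g, hx.symm]) (by simp)]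
      simp only [g, if_true, S]
      rw [Finset.sum_range_succ, mul_add, Real.exp_add]
    have h2 : ∀ x, ∫ G, g x G * Real.exp (c * G.adjNat x.1 x.2) ∂binomialRandom (Fin n) p =
        (1 + p * (Real.exp c - 1)) * ∫ G, g x G ∂binomialRandom (Fin n) p := by
      intro x
      by_cases hx : ∃ G, f T G = x
      · obtain ⟨G₀, hG₀⟩ := hx
        have hx1 : x.1 < x.2 := hG₀ ▸ hlt T (by omega) G₀
        have hx2 : rank x = T := hG₀ ▸ hrank T (by omega) G₀
        refine integral_mul_exp_adj hx1.ne _ (fun G => ?_) c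
        have h3 : ∀ y : Fin n × Fin n, y.1 < y.2 → rank y < T →
            (G ⊔ edge x.1 x.2).adjNat y.1 y.2 = G.adjNat y.1 y.2 := by
          intro y hy hyT
          refine adjNat_sup_edge hx1 hy ?_
          intro h
          obtain rfl : y = x := h
          exact absurd hyT (by simp [hx2])
        have h4 : ∀ t ≤ T, f t (G ⊔ edge x.1 x.2) = f t G := fun t ht =>
          hadapt t (by omega) _ _ fun y hy hyt => h3 y hy (by omega)
        have h5 : S (G ⊔ edge x.1 x.2) = S G := by
          simp only [S]
          congr 2
          refine Finset.sum_congr rfl fun t ht => ?_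
          have ht' := Finset.mem_range.1 ht
          rw [h4 t ht'.le, h3 (f t G) (hlt t (by omega) G)]
          rw [hrank t (by omega)]
          exact ht'
        simp only [g, h4 T le_rfl, h5]
      · have : ∀ G, g x G = 0 := fun G => by simp only [g]; rw [if_neg fun h => hx ⟨G, h⟩]
        simp [this]
    simp_rw [h1]
    rw [integral_finsetSum _ fun _ _ => .of_finite]
    simp_rw [h2]
    rw [← Finset.mul_sum, ← integral_finsetSum _ fun _ _ => .of_finite]
    simp_rw [hsum]
    rw [pow_succ', ← ih (fun t ht => hlt t (by omega)) (fun t ht => hrank t (by omega))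
      fun t ht => hadapt t (by omega)]

end SimpleGraph

/-! ### The learner on a random graph without planted structure -/

theorem edgeRound_congr {n : ℕ} {G G' : SimpleGraph (Fin n)} {m : ℕ} {h : 0 < m ∧ 2 * m ≤ n}
    {t : Fin (m * m)}
    (hG : ∀ a b : Fin (n / (2 * m)),
      G.adjNat (t / m * (n / (2 * m)) + a) ((m + t % m) * (n / (2 * m)) + b) =
        G'.adjNat (t / m * (n / (2 * m)) + a) ((m + t % m) * (n / (2 * m)) + b)) :
    edgeRound G m h t = edgeRound G' m h t := by
  simp only [edgeRound, Round.mk.injEq, true_and]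
  funext a b
  rw [hG]

/-- The number of a vertex in a block. -/
theorem blockVertex_lt {n m i a : ℕ} (hi : i < 2 * m) (ha : a < n / (2 * m)) :
    i * (n / (2 * m)) + a < n := by
  have h1 : 2 * m * (n / (2 * m)) ≤ n := Nat.mul_div_le _ _
  have h2 : (i + 1) * (n / (2 * m)) ≤ 2 * m * (n / (2 * m)) := Nat.mul_le_mul_right _ hi
  rw [add_mul] at h2
  omega

theorem blockVertex_div {L i a : ℕ} (ha : a < L) : (i * L + a) / L = i := by
  rw [mul_comm, Nat.mul_add_div (by omega), Nat.div_eq_of_lt ha, add_zero]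

theorem blockVertex_lt_blockVertex {L i j a b : ℕ} (hij : i < j) (ha : a < L) :
    i * L + a < j * L + b := by
  have := Nat.mul_le_mul_right L (Nat.succ_le_of_lt hij)
  rw [Nat.succ_mul] at this
  omega

namespace Learner
variable (A : Learner) {n : ℕ} {p : unitInterval}

/-- For fixed coins the learner is an adaptive querier: the past rounds reveal only edges between
pairs of blocks that were asked before. -/
theorem integral_exp_gain {m : ℕ} (h : 0 < m ∧ 2 * m ≤ n) (r : Fin (A.blockCoins n m) → Bool)
    (c : ℝ) :
    ∫ G : SimpleGraph (Fin n), Real.exp (c * (∑ t, A.gain G m h r t : ℕ))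
      ∂SimpleGraph.binomialRandom (Fin n) p = (1 + p * (Real.exp c - 1)) ^ (m * m) := by
  let f : ℕ → SimpleGraph (Fin n) → Fin n × Fin n := fun t G =>
    if ht : t < m * m then
      (⟨t / m * (n / (2 * m)) + (A.answer G m h r ⟨t, ht⟩).1, blockVertex_lt (by
          have := Nat.div_lt_of_lt_mul ht; omega) (A.answer G m h r ⟨t, ht⟩).1.2⟩,
        ⟨(m + t % m) * (n / (2 * m)) + (A.answer G m h r ⟨t, ht⟩).2, blockVertex_lt (by
          have := Nat.mod_lt t h.1; omega) (A.answer G m h r ⟨t, ht⟩).2.2⟩)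
    else (⟨0, by omega⟩, ⟨0, by omega⟩)
  have key := SimpleGraph.integral_exp_adaptive (p := p)
    -- The rank of a pair of vertices is the round that asks for their two blocks.
    (fun x => x.1 / (n / (2 * m)) * m + (x.2 / (n / (2 * m)) - m)) f (m * m) ?_ ?_ ?_ c
  · rw [← key]
    congr 1
    ext G
    rw [Finset.sum_range]
    push_cast
    congr 2
    refine Finset.sum_congr rfl fun t _ => ?_
    simp only [f, t.2, dif_pos, gain]
  · intro t ht G
    simp only [f, ht, dif_pos, Fin.mk_lt_mk]
    have := Nat.div_lt_of_lt_mul ht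
    exact blockVertex_lt_blockVertex (by omega) (Fin.is_lt _)
  · intro t ht G
    simp only [f, ht, dif_pos]
    rw [blockVertex_div (Fin.is_lt _), blockVertex_div (Fin.is_lt _), Nat.add_sub_cancel_left]
    exact Nat.div_add_mod' t m
  · intro t ht G G' hG
    have h1 : (List.ofFn (edgeRound G m h)).take t = (List.ofFn (edgeRound G' m h)).take t := by
      refine List.ext_getElem (by simp) fun s hs hs' => ?_
      simp only [List.length_take, List.length_ofFn, lt_min_iff] at hs
      simp only [List.getElem_take, List.getElem_ofFn]
      refine edgeRound_congr fun a b => ?_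
      have hsm := Nat.div_lt_of_lt_mul hs.2
      have hsm' := Nat.mod_lt s h.1
      refine hG (⟨_, blockVertex_lt (by simp only; omega) a.2⟩,
        ⟨_, blockVertex_lt (by simp only; omega) b.2⟩) ?_ ?_
      · exact blockVertex_lt_blockVertex (by simp only; omega) a.2
      · simp only
        rw [blockVertex_div a.2, blockVertex_div b.2, Nat.add_sub_cancel_left, Nat.div_add_mod']
        exact hs.1
    have h2 : A.answer G m h r ⟨t, ht⟩ = A.answer G' m h r ⟨t, ht⟩ := by
      exact congrArg (fun l => A.predict (blockGame n m h) r l _) h1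
    simp only [f, ht, dif_pos, h2]

/-- The `n` runs share the graph and are not independent, but by Jensen's inequality the exponential
of their mean is at most the mean of the exponentials, so the Chernoff bound for one run applies.
The base satisfies `1 + p * (exp 1 - 1) ≤ exp (2 * p)`, and the excess `3 * m` remains. -/
theorem measureReal_totalGain_ge {Q : ℕ} {m : ℕ} (h : 0 < m ∧ 2 * m ≤ n) (r : Fin Q → Bool) :
    (SimpleGraph.binomialRandom (Fin n) p).real
      {G | 2 * (p : ℝ) * (m * m) + 3 * m ≤ (A.totalGain G m h r : ℝ) / (n : ℝ)} ≤
      Real.exp (-3) ^ m := by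
  have hn : 0 < (n : ℝ) := by have := h; exact_mod_cast (by omega : 0 < n)
  set μ := SimpleGraph.binomialRandom (Fin n) p
  have h1 := mul_meas_ge_le_integral_of_nonneg (μ := μ)
    (f := fun G => Real.exp ((A.totalGain G m h r : ℝ) / n))
    (.of_forall fun _ => (Real.exp_pos _).le) .of_finite (Real.exp (2 * p * (m * m) + 3 * m))
  simp only [Real.exp_le_exp] at h1
  have h2 : ∫ G, Real.exp ((A.totalGain G m h r : ℝ) / n) ∂μ ≤
      (1 + p * (Real.exp 1 - 1)) ^ (m * m) := by
    have h3 : ∀ G : SimpleGraph (Fin n), Real.exp ((A.totalGain G m h r : ℝ) / n) ≤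
        ∑ i : Fin n, 1 / (n : ℝ) *
          Real.exp (1 * (∑ t, A.gain G m h (coinBlock r (A.blockCoins n m) i) t : ℕ)) := by
      intro G
      have := convexOn_exp.map_sum_le (t := Finset.univ) (w := fun _ : Fin n => 1 / (n : ℝ))
        (p := fun i => 1 * ((∑ t, A.gain G m h (coinBlock r (A.blockCoins n m) i) t : ℕ) : ℝ))
        (fun _ _ => by positivity) (by simp [hn.ne']) (by simp)
      simp only [smul_eq_mul, ← Finset.mul_sum, one_mul] at this ⊢
      refine le_trans (le_of_eq ?_) this
      congr 1
      rw [totalGain]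
      push_cast
      ring
    calc _ ≤ ∫ G, ∑ i : Fin n, 1 / (n : ℝ) *
          Real.exp (1 * (∑ t, A.gain G m h (coinBlock r (A.blockCoins n m) i) t : ℕ)) ∂μ :=
          integral_mono .of_finite .of_finite h3
      _ = (1 + p * (Real.exp 1 - 1)) ^ (m * m) := by
          rw [integral_finsetSum _ fun _ _ => .of_finite]
          simp_rw [integral_const_mul, μ, integral_exp_gain]
          rw [Finset.sum_const, Finset.card_univ, Fintype.card_fin, nsmul_eq_mul]
          field_simp
  have h5 : 0 ≤ (p : ℝ) := p.2.1
  have h3 : (1 + p * (Real.exp 1 - 1)) ^ (m * m) ≤ Real.exp (2 * p * (m * m)) := by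
    have h4 := Real.exp_one_lt_d9
    have h6 := Real.add_one_le_exp (2 * (p : ℝ))
    have h7 := Real.add_one_le_exp 1
    calc (1 + p * (Real.exp 1 - 1)) ^ (m * m) ≤ Real.exp (2 * p) ^ (m * m) :=
          pow_le_pow_left₀ (by nlinarith) (by nlinarith) _
      _ = Real.exp (2 * p * (m * m)) := by
          rw [← Real.exp_nat_mul]
          push_cast
          ring_nf
  have h4 : Real.exp (2 * p * (m * m)) =
      Real.exp (2 * p * (m * m) + 3 * m) * Real.exp (-3) ^ m := by
    rw [← Real.exp_nat_mul, ← Real.exp_add]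
    ring_nf
  rw [h4] at h3
  exact le_of_mul_le_mul_left (h1.trans (h2.trans h3)) (Real.exp_pos _)

theorem _root_.SimpleGraph.two_mul_countAdj_le (G : SimpleGraph (Fin n)) :
    2 * G.countAdj (Finset.univ.filter fun x => x.1 < x.2) ≤ G.adjSum := by
  classical
  rw [SimpleGraph.adjSum, ← Fintype.sum_prod_type' (f := fun u v : Fin n => G.adjNat u v), two_mul]
  have h1 : G.countAdj (Finset.univ.filter fun x => x.1 < x.2) =
      ∑ x ∈ Finset.univ.filter fun x : Fin n × Fin n => x.2 < x.1, G.adjNat x.1 x.2 := by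
    refine Finset.sum_bij' (fun x _ => x.swap) (fun x _ => x.swap) ?_ ?_ ?_ ?_ ?_ <;> simp
    intro a b _
    simp only [SimpleGraph.adjNat_fin, G.adj_comm]
  nth_rw 2 [h1]
  rw [SimpleGraph.countAdj, ← Finset.sum_union]
  · exact Finset.sum_le_sum_of_subset (Finset.subset_univ _)
  · rw [Finset.disjoint_filter]
    intro x _ hx
    exact hx.asymm

theorem _root_.card_filter_lt_fin (n : ℕ) :
    ((Finset.univ.filter fun x : Fin n × Fin n => x.1 < x.2).card : ℝ) = n * (n - 1) / 2 := by
  have h1 : (Finset.univ.filter fun x : Fin n × Fin n => x.1 < x.2).card =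
      ∑ v : Fin n, (v : ℕ) := by
    rw [Finset.card_filter, Fintype.sum_prod_type_right]
    refine Finset.sum_congr rfl fun v _ => ?_
    rw [← Fin.card_Iio v, ← Finset.card_filter]
    congr 1
    ext
    simp
  have h2 := Finset.sum_range_id_mul_two n
  rw [Finset.sum_range, ← h1] at h2
  rcases Nat.eq_zero_or_pos n with rfl | hn
  · simp
  · rw [eq_div_iff two_ne_zero]
    have := congrArg (Nat.cast (R := ℝ)) h2
    push_cast [Nat.cast_sub hn] at this
    exact this

theorem exp_neg_three_le : Real.exp (-3) ≤ 1 / 19 := by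
  have h2 : Real.exp 3 = Real.exp 1 ^ 3 := by rw [← Real.exp_nat_mul]; norm_num
  have h3 := Real.exp_one_gt_d9
  have h4 : (2.7 : ℝ) ^ 3 ≤ Real.exp 1 ^ 3 := pow_le_pow_left₀ (by norm_num) (by linarith) 3
  rw [Real.exp_neg, inv_le_comm₀ (Real.exp_pos _) (by norm_num), h2]
  norm_num at h4 ⊢
  linarith

theorem exp_neg_six_le : Real.exp (-6) ≤ 1 / 80 := by
  have h1 : Real.exp (-6) = Real.exp (-3) * Real.exp (-3) := by rw [← Real.exp_add]; norm_num
  nlinarith [Real.exp_pos (-3), exp_neg_three_le]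

theorem sum_exp_neg_three_le (N : ℕ) : ∑ x : Fin N, Real.exp (-3) ^ (x + 1 : ℕ) ≤ 1 / 18 := by
  calc ∑ x : Fin N, Real.exp (-3) ^ (x + 1 : ℕ) ≤ ∑ x : Fin N, (1 / 19 : ℝ) ^ (x + 1 : ℕ) :=
        Finset.sum_le_sum fun x _ => pow_le_pow_left₀ (Real.exp_pos _).le exp_neg_three_le _
    _ = (1 - (1 / 19 : ℝ) ^ N) / 18 := by
        rw [Fin.sum_univ_eq_sum_range (fun x => (1 / 19 : ℝ) ^ (x + 1))]
        induction N with
        | zero => simp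
        | succ N ih => rw [Finset.sum_range_succ, ih]; ring
    _ ≤ 1 / 18 := by
        have : (0 : ℝ) ≤ (1 / 19) ^ N := by positivity
        linarith

/-- Unless the graph has too few edges, the empirical threshold is at least `2 * p * m² + 3 * m`;
the failure probabilities `exp (-3) ^ m` form a geometric series. The bound is uniform in the coins.
-/
theorem measureReal_exceeds_le {Q : ℕ} (r : Fin Q → Bool) (hn : 2 ≤ n)
    (hp : 24 ≤ p * ((n : ℝ) * (n - 1))) :
    (SimpleGraph.binomialRandom (Fin n) p).real {G | ∃ x, A.Exceeds G r x} ≤ 1 / 5 := by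
  classical
  set μ := SimpleGraph.binomialRandom (Fin n) p
  set F := Finset.univ.filter fun x : Fin n × Fin n => x.1 < x.2
  have hF : (F.card : ℝ) = n * (n - 1) / 2 := card_filter_lt_fin n
  have hn' : (2 : ℝ) ≤ n := by exact_mod_cast hn
  have hsub : {G | ∃ x, A.Exceeds G r x} ⊆ {G | (G.countAdj F : ℝ) ≤ p * F.card / 4} ∪
      ⋃ x : Fin (n / 2), {G | 2 * (p : ℝ) * ((x + 1 : ℕ) * (x + 1 : ℕ)) + 3 * (x + 1 : ℕ) ≤
        (A.totalGain G (x + 1) (by omega) r : ℝ) / (n : ℝ)} := by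
    rintro G ⟨x, hx⟩
    by_cases hG : (G.countAdj F : ℝ) ≤ p * F.card / 4
    · exact Or.inl hG
    · refine Or.inr (Set.mem_iUnion.2 ⟨x, ?_⟩)
      rw [not_le, hF] at hG
      have h1 : (2 * G.countAdj F : ℝ) ≤ G.adjSum := by exact_mod_cast G.two_mul_countAdj_le
      have h2 : (16 * G.adjSum * ((x + 1 : ℕ) * (x + 1 : ℕ)) + 3 * (x + 1 : ℕ) * (n * n) : ℝ) ≤
          n * A.totalGain G (x + 1) (by omega) r := by exact_mod_cast hx
      -- This is where the factor 16 of `Exceeds` comes from: 16 times the density is at least `2 *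
      -- p`.
      have h3 : (p * (n * n) : ℝ) / 8 ≤ G.adjSum := by
        have h5 : 0 ≤ (p : ℝ) := p.2.1
        have : (p * (n * n) : ℝ) ≤ p * (2 * (n * (n - 1))) :=
          mul_le_mul_of_nonneg_left (by nlinarith) h5
        nlinarith
      simp only [Set.mem_ofPred_eq]
      rw [le_div_iff₀ (by linarith), ← mul_le_mul_iff_right₀ (show (0 : ℝ) < n by linarith)]
      refine le_trans ?_ h2
      have h4 : (0 : ℝ) ≤ (x + 1 : ℕ) * (x + 1 : ℕ) := by positivity
      nlinarith [mul_le_mul_of_nonneg_right h3 h4]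
  have h1 : μ.real {G | (G.countAdj F : ℝ) ≤ p * F.card / 4} ≤ 1 / 19 := by
    refine (SimpleGraph.measureReal_countAdj_le F (by simp [F])).trans ?_
    refine le_trans (Real.exp_le_exp.2 ?_) exp_neg_three_le
    rw [hF]
    linarith
  calc _ ≤ _ := measureReal_mono hsub
    _ ≤ μ.real {G | (G.countAdj F : ℝ) ≤ p * F.card / 4} +
        ∑ x : Fin (n / 2), μ.real {G | 2 * (p : ℝ) * ((x + 1 : ℕ) * (x + 1 : ℕ)) + 3 * (x + 1 : ℕ) ≤
          (A.totalGain G (x + 1) (by omega) r : ℝ) / (n : ℝ)} :=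
        (measureReal_union_le _ _).trans (add_le_add_right (measureReal_iUnion_fintype_le _) _)
    _ ≤ 1 / 19 + ∑ x : Fin (n / 2), Real.exp (-3) ^ (x + 1 : ℕ) :=
        add_le_add h1 (Finset.sum_le_sum fun x _ =>
          A.measureReal_totalGain_ge (m := x + 1) (by omega) r)
    _ ≤ 1 / 5 := by
        have := sum_exp_neg_three_le (n / 2)
        linarith

end Learner

/-! ### Independent blocks of coins -/

/-- Coordinates outside the range of `φ` are averaged out. -/
theorem expect_comp_injective {α β : Type*} [Fintype α] [Fintype β] [DecidableEq α] [DecidableEq β]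
    {φ : α → β} (hφ : φ.Injective) (F : (α → Bool) → ℝ) :
    (Finset.univ.expect fun r : β → Bool => F fun a => r (φ a)) = Finset.univ.expect F := by
  classical
  let E : (β → Bool) ≃ (α → Bool) × ({b // ¬ b ∈ Set.range φ} → Bool) :=
    (Equiv.piEquivPiSubtypeProd (· ∈ Set.range φ) fun _ => Bool).trans
      (((Equiv.ofInjective φ hφ).arrowCongr (Equiv.refl Bool)).symm.prodCongr (Equiv.refl _))
  refine (Fintype.expect_equiv E _ (fun x => F x.1) fun r => rfl).trans ?_
  rw [← Finset.univ_product_univ, Finset.expect_product]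
  simp

theorem expect_prod_pow {γ : Type*} [Fintype γ] (n : ℕ) (g : γ → ℝ) :
    (Finset.univ.expect fun s : Fin n → γ => ∏ i, g (s i)) = (Finset.univ.expect g) ^ n := by
  classical
  rw [Fintype.expect_eq_sum_div_card, Fintype.expect_eq_sum_div_card, div_pow]
  congr 1
  · have := Finset.prod_univ_sum (fun _ : Fin n => (Finset.univ : Finset γ)) fun _ x => g x
    simp only [Finset.prod_const, Finset.card_univ, Fintype.card_fin, Fintype.piFinset_univ] at this
    exact this.symm
  · simp

/-- With `n * c ≤ Q` no block is padded, and disjoint blocks of fair coins are independent. -/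
theorem expect_prod_coinBlock {Q c n : ℕ} (h : n * c ≤ Q) (g : (Fin c → Bool) → ℝ) :
    (Finset.univ.expect fun r : Fin Q → Bool => ∏ i : Fin n, g (coinBlock r c i)) =
      (Finset.univ.expect g) ^ n := by
  classical
  have hlt : ∀ x : Fin n × Fin c, x.1 * c + x.2 < Q := fun x => by
    have := Nat.mul_le_mul_right c (Nat.succ_le_of_lt x.1.2)
    have := x.2.2
    rw [Nat.succ_mul] at *
    omega
  have hφ : (fun x : Fin n × Fin c => (⟨x.1 * c + x.2, hlt x⟩ : Fin Q)).Injective := by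
    rintro ⟨i, a⟩ ⟨j, b⟩ hx
    simp only [Fin.mk.injEq] at hx
    have h1 : (i : ℕ) = j := by rw [← blockVertex_div (i := i) a.2, hx, blockVertex_div b.2]
    rw [h1] at hx
    exact Prod.ext (Fin.ext h1) (Fin.ext (by simpa using hx))
  rw [← expect_prod_pow, ← Fintype.expect_equiv (Equiv.curry (Fin n) (Fin c) Bool)
    (fun s => ∏ i, g fun a => s (i, a)) _ fun s => rfl, ← expect_comp_injective hφ]
  refine Finset.expect_congr rfl fun r _ => Finset.prod_congr rfl fun i _ => ?_
  congr 1
  funext a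
  simp [coinBlock, hlt (i, a)]

theorem integral_uniformOn_univ {α : Type*} [Fintype α] [Nonempty α] [MeasurableSpace α]
    [MeasurableSingletonClass α] (f : α → ℝ) :
    ∫ x, f x ∂ProbabilityTheory.uniformOn Set.univ = Finset.univ.expect f := by
  rw [integral_fintype .of_finite, Fintype.expect_eq_sum_div_card, Finset.sum_div]
  refine Finset.sum_congr rfl fun x _ => ?_
  simp [measureReal_def, ProbabilityTheory.uniformOn_univ, div_eq_inv_mul]

/-- Convexity puts the exponential below its chord over `[-1, 0]`, and `exp (-1) ≤ 1 / 2`. -/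
theorem exp_neg_le_one_sub_half {y : ℝ} (h0 : 0 ≤ y) (h1 : y ≤ 1) : Real.exp (-y) ≤ 1 - y / 2 := by
  have h2 := convexOn_exp.2 (Set.mem_univ 0) (Set.mem_univ (-1)) (sub_nonneg.2 h1) h0 (by ring)
  simp only [smul_eq_mul, mul_zero, zero_add, Real.exp_zero, mul_one, mul_neg] at h2
  have h4 : Real.exp (-1) ≤ 1 / 2 := by
    have := Real.exp_one_gt_d9
    rw [Real.exp_neg, inv_le_comm₀ (Real.exp_pos _) (by norm_num)]
    linarith
  nlinarith

/-- The sum of independent copies of a bounded variable is at least a quarter of its mean. -/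
theorem uniformOn_sum_coinBlock_le {Q c n : ℕ} (h : n * c ≤ Q) (X : (Fin c → Bool) → ℝ) {T μ : ℝ}
    (hT : 0 < T) (hX0 : ∀ r, 0 ≤ X r) (hXT : ∀ r, X r ≤ T) (hμ : μ ≤ Finset.univ.expect X) :
    (ProbabilityTheory.uniformOn Set.univ).real
      {r : Fin Q → Bool | ∑ i : Fin n, X (coinBlock r c i) ≤ n * μ / 4} ≤
      Real.exp (-(n * μ / (4 * T))) := by
  have h1 := mul_meas_ge_le_integral_of_nonneg
    (μ := ProbabilityTheory.uniformOn (Set.univ : Set (Fin Q → Bool)))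
    (f := fun r => ∏ i : Fin n, Real.exp (-(X (coinBlock r c i) / T)))
    (.of_forall fun _ => Finset.prod_nonneg fun _ _ => (Real.exp_pos _).le) .of_finite
    (Real.exp (-(n * μ / (4 * T))))
  rw [integral_uniformOn_univ, expect_prod_coinBlock h (fun s => Real.exp (-(X s / T)))] at h1
  have h2 : {r : Fin Q → Bool | ∑ i : Fin n, X (coinBlock r c i) ≤ n * μ / 4} =
      {r | Real.exp (-(n * μ / (4 * T))) ≤ ∏ i : Fin n, Real.exp (-(X (coinBlock r c i) / T))} := by
    ext r
    simp only [Set.mem_ofPred_eq]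
    rw [← Real.exp_sum, Real.exp_le_exp, Finset.sum_neg_distrib, neg_le_neg_iff, ← Finset.sum_div,
      ← div_div, div_le_div_iff_of_pos_right hT]
  rw [h2]
  have h3 : (Finset.univ.expect fun s => Real.exp (-(X s / T))) ≤ Real.exp (-(μ / (2 * T))) := by
    calc (Finset.univ.expect fun s => Real.exp (-(X s / T))) ≤
          Finset.univ.expect fun s => (1 - X s * (1 / (2 * T))) := by
          refine Finset.expect_le_expect fun s _ => ?_
          refine (exp_neg_le_one_sub_half (div_nonneg (hX0 s) hT.le)
            ((div_le_one hT).2 (hXT s))).trans (le_of_eq ?_)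
          field_simp
      _ = 1 - (Finset.univ.expect X) * (1 / (2 * T)) := by
          rw [Finset.expect_sub_distrib, Finset.expect_mul]
          simp
      _ ≤ 1 - μ / (2 * T) := by
          rw [mul_one_div]
          gcongr
      _ ≤ _ := by
          have := Real.add_one_le_exp (-(μ / (2 * T)))
          linarith
  have h4 : (Finset.univ.expect fun s => Real.exp (-(X s / T))) ^ n ≤
      Real.exp (-(n * μ / (4 * T))) * Real.exp (-(n * μ / (4 * T))) := by
    refine (pow_le_pow_left₀ (Finset.expect_nonneg fun _ _ => (Real.exp_pos _).le) h3 n).trans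
      (le_of_eq ?_)
    rw [← Real.exp_nat_mul, ← Real.exp_add]
    congr 1
    field_simp
    ring
  exact le_of_mul_le_mul_left (h1.trans h4) (Real.exp_pos _)

/-! ### The learner on a graph with a good labeling -/

/-- The number of edges between the chosen vertices of the blocks `i < m` and `m ≤ j`. -/
noncomputable def labelValue {n : ℕ} (G : SimpleGraph (Fin n)) (m : ℕ) (h : 0 < m ∧ 2 * m ≤ n)
    (l : Fin (2 * m) → Fin (n / (2 * m))) : ℕ :=
  ∑ t, G.adjNat (t / m * (n / (2 * m)) + l (edgeRound G m h t).fst)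
    ((m + t % m) * (n / (2 * m)) + l (edgeRound G m h t).snd)

theorem labelValue_le_opt {n : ℕ} (G : SimpleGraph (Fin n)) (m : ℕ) (h : 0 < m ∧ 2 * m ≤ n)
    (l : Fin (2 * m) → Fin (n / (2 * m))) : (labelValue G m h l : ℝ) ≤ opt (edgeRound G m h) := by
  refine le_trans (le_of_eq ?_) (le_ciSup (Set.finite_range _).bddAbove l)
  simp [labelValue, edgeRound]

namespace Learner
variable (A : Learner)

theorem expectedPayoff_edgeRound {n : ℕ} (G : SimpleGraph (Fin n)) (m : ℕ) (h : 0 < m ∧ 2 * m ≤ n) :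
    A.expectedPayoff (blockGame n m h) (edgeRound G m h) =
      Finset.univ.expect fun r => ((∑ t, A.gain G m h r t : ℕ) : ℝ) := by
  unfold expectedPayoff
  refine Finset.expect_congr rfl fun r _ => ?_
  rw [Nat.cast_sum]
  refine Finset.sum_congr rfl fun t _ => ?_
  exact Rat.cast_natCast _

/-- The optimum is at least `B`, so a run earns `B / 2` on average, and a quarter of the mean of `n`
runs is `n * B / 8`. Each run earns at most `m * m`, which sets the exponent. -/
theorem uniformOn_totalGain_le {n Q : ℕ} {G : SimpleGraph (Fin n)} {m : ℕ} {h : 0 < m ∧ 2 * m ≤ n}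
    (hQ : n * A.blockCoins n m ≤ Q) {B : ℝ} {l : Fin (2 * m) → Fin (n / (2 * m))}
    (hl : B ≤ labelValue G m h l) (hreg : A.regret (blockGame n m h) (edgeRound G m h) ≤ B / 2) :
    (ProbabilityTheory.uniformOn Set.univ).real
      {r : Fin Q → Bool | (A.totalGain G m h r : ℝ) ≤ n * B / 8} ≤
      Real.exp (-(n * B / (8 * (m * m)))) := by
  have h1 : B / 2 ≤ Finset.univ.expect fun r => ((∑ t, A.gain G m h r t : ℕ) : ℝ) := by
    rw [← expectedPayoff_edgeRound]
    have h2 := hl.trans (labelValue_le_opt G m h l)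
    unfold regret at hreg
    change opt (edgeRound G m h) - _ ≤ _ at hreg
    linarith
  have hm : (0 : ℝ) < m := by exact_mod_cast h.1
  have h3 := uniformOn_sum_coinBlock_le (T := m * m) hQ _ (by positivity) (fun r => by positivity)
    (fun r => ?_) h1
  · convert h3 using 3
    · ext r
      simp only [totalGain]
      push_cast
      rw [mul_div_assoc' _ B, div_div]
      norm_num
    · field_simp
      ring
  · have : ∑ t, A.gain G m h r t ≤ ∑ t : Fin (m * m), 1 :=
      Finset.sum_le_sum fun t _ => G.adjNat_le_one _ _
    rw [Finset.sum_const, Finset.card_univ, Fintype.card_fin, smul_eq_mul, mul_one] at this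
    exact_mod_cast this

end Learner

/-! ### The blocks that meet a random set -/

/-- Factor by factor, `(n - L - k) / (n - k) ≤ (n - L) / n`: drawing without replacement avoids `L`
given points at most as often as drawing with replacement. -/
theorem descFactorial_sub_mul_pow_le (n L k : ℕ) (hL : L ≤ n) :
    (n - L).descFactorial k * n ^ k ≤ n.descFactorial k * (n - L) ^ k := by
  induction k with
  | zero => simp
  | succ k ih =>
    rw [Nat.descFactorial_succ, Nat.descFactorial_succ, pow_succ, pow_succ]
    have h1 : (n - L - k) * n ≤ (n - k) * (n - L) := by
      rcases Nat.le_total (n - L) k with h | h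
      · simp [Nat.sub_eq_zero_of_le h]
      · have h2 : k ≤ n := by omega
        zify [h, h2, hL]
        nlinarith
    calc (n - L - k) * (n - L).descFactorial k * (n ^ k * n)
        = ((n - L - k) * n) * ((n - L).descFactorial k * n ^ k) := by ring
      _ ≤ ((n - k) * (n - L)) * (n.descFactorial k * (n - L) ^ k) := Nat.mul_le_mul h1 ih
      _ = _ := by ring

theorem choose_sub_le {n L k : ℕ} (hn : 0 < n) (hL : L ≤ n) :
    ((n - L).choose k : ℝ) ≤ Real.exp (-(k * L / n)) * n.choose k := by
  have h1 : (n - L).choose k * n ^ k ≤ n.choose k * (n - L) ^ k := by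
    have := descFactorial_sub_mul_pow_le n L k hL
    rw [Nat.descFactorial_eq_factorial_mul_choose, Nat.descFactorial_eq_factorial_mul_choose,
      mul_assoc, mul_assoc] at this
    exact Nat.le_of_mul_le_mul_left this (Nat.factorial_pos k)
  have hn' : (0 : ℝ) < n := by exact_mod_cast hn
  have h2 : ((n - L).choose k : ℝ) * n ^ k ≤ n.choose k * (n - L) ^ k := by
    rw [← Nat.cast_sub hL]
    exact_mod_cast h1
  have h3 : ((n : ℝ) - L) ^ k ≤ Real.exp (-(k * L / n)) * n ^ k := by
    have h4 : (n : ℝ) - L ≤ Real.exp (-(L / n)) * n := by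
      have := mul_le_mul_of_nonneg_right (Real.add_one_le_exp (-((L : ℝ) / n))) hn'.le
      refine le_trans (le_of_eq ?_) this
      field_simp
      ring
    have h5 : (0 : ℝ) ≤ n - L := sub_nonneg.2 (by exact_mod_cast hL)
    refine (pow_le_pow_left₀ h5 h4 k).trans (le_of_eq ?_)
    rw [mul_pow, ← Real.exp_nat_mul]
    ring_nf
  have h6 : ((n - L).choose k : ℝ) * n ^ k ≤ (Real.exp (-(k * L / n)) * n.choose k) * n ^ k :=
    h2.trans ((mul_le_mul_of_nonneg_left h3 (Nat.cast_nonneg _)).trans (le_of_eq (by ring)))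
  exact le_of_mul_le_mul_right h6 (by positivity)

section Blocks
variable {n m : ℕ}

/-- The vertex with number `a` in the block `i`. -/
def blockVertex (i : Fin (2 * m)) (a : Fin (n / (2 * m))) : Fin n :=
  ⟨i * (n / (2 * m)) + a, blockVertex_lt i.2 a.2⟩

theorem blockVertex_inj {i j : Fin (2 * m)} {a b : Fin (n / (2 * m))}
    (h : blockVertex i a = blockVertex j b) : i = j ∧ a = b := by
  simp only [blockVertex, Fin.mk.injEq] at h
  have h1 : (i : ℕ) = j := by rw [← blockVertex_div (i := i) a.2, h, blockVertex_div b.2]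
  rw [h1] at h
  exact ⟨Fin.ext h1, Fin.ext (by omega)⟩

open Classical in
/-- The blocks that do not meet `S`. -/
noncomputable def missed (m : ℕ) (S : Finset (Fin n)) : Finset (Fin (2 * m)) :=
  Finset.univ.filter fun i => ∀ a : Fin (n / (2 * m)), blockVertex i a ∉ S

theorem card_missing (i : Fin (2 * m)) (k : ℕ) :
    ((Finset.powersetCard k Finset.univ).filter fun S : Finset (Fin n) => i ∈ missed m S).card =
      (n - n / (2 * m)).choose k := by
  classical
  let B : Finset (Fin n) := Finset.univ.map ⟨blockVertex i, fun _ _ h => (blockVertex_inj h).2⟩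
  have hB : B.card = n / (2 * m) := by simp [B]
  have : (Finset.powersetCard k Finset.univ).filter (fun S : Finset (Fin n) => i ∈ missed m S) =
      Finset.powersetCard k Bᶜ := by
    ext S
    simp only [missed, Finset.mem_filter, Finset.mem_powersetCard, Finset.subset_univ, true_and,
      Finset.mem_univ, Finset.subset_compl_iff_disjoint_right, Finset.disjoint_right, B,
      Finset.mem_map, forall_exists_index, forall_apply_eq_imp_iff]
    exact and_comm
  rw [this, Finset.card_powersetCard, Finset.card_compl, hB, Fintype.card_fin]

/-- Few sets miss more than a quarter of the blocks. -/
theorem card_many_missed_le (hm : 0 < m) (hmn : 2 * m ≤ n) {k : ℕ}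
    (hk : 10 * n ≤ k * (n / (2 * m))) :
    (((Finset.powersetCard k Finset.univ).filter fun S : Finset (Fin n) =>
      m < 2 * (missed m S).card).card : ℝ) ≤ 1 / 20 * n.choose k := by
  classical
  set P := Finset.powersetCard k (Finset.univ : Finset (Fin n))
  have hn : (0 : ℝ) < n := by exact_mod_cast (by omega : 0 < n)
  have h1 : ∑ S ∈ P, (missed m S).card = 2 * m * (n - n / (2 * m)).choose k := by
    have : ∀ S : Finset (Fin n), (missed m S).card = ∑ i, if i ∈ missed m S then 1 else 0 := by
      intro S
      simp
    simp_rw [this]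
    rw [Finset.sum_comm]
    simp_rw [← Finset.card_filter, P, card_missing]
    simp
  -- Markov's inequality as a double count: on average at most `2 * m / 80` blocks are missed, so
  -- more than `m / 2` are missed with probability at most `1 / 20`.
  have h2 : (P.filter fun S => m < 2 * (missed m S).card).card * m ≤
      2 * ∑ S ∈ P, (missed m S).card := by
    rw [Finset.mul_sum, Finset.card_eq_sum_ones, Finset.sum_mul]
    refine (Finset.sum_le_sum fun S hS => ?_).trans
      (Finset.sum_le_sum_of_subset (Finset.filter_subset (fun S => m < 2 * (missed m S).card) P))
    have := (Finset.mem_filter.1 hS).2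
    omega
  have h3 : ((n - n / (2 * m)).choose k : ℝ) ≤ 1 / 80 * n.choose k := by
    refine (choose_sub_le (by omega) (Nat.div_le_self _ _)).trans ?_
    refine mul_le_mul_of_nonneg_right ?_ (Nat.cast_nonneg _)
    have h4 : (10 : ℝ) ≤ k * (n / (2 * m) : ℕ) / n := by
      rw [le_div_iff₀ hn]
      exact_mod_cast hk
    exact (Real.exp_le_exp.2 (by linarith)).trans Learner.exp_neg_six_le
  rw [h1] at h2
  have h4 : ((P.filter fun S => m < 2 * (missed m S).card).card : ℝ) * m ≤
      2 * (2 * m * (n - n / (2 * m)).choose k : ℕ) := by exact_mod_cast h2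
  have hm' : (0 : ℝ) < m := by exact_mod_cast hm
  refine le_of_mul_le_mul_right (h4.trans ?_) hm'
  push_cast
  nlinarith

end Blocks

/-! ### The planted graph -/

section Planted
variable {n m : ℕ} {p q : unitInterval}

theorem adjNat_plant_of_mem {S : Finset (Fin n)} {H K : SimpleGraph (Fin n)} {u v : Fin n}
    (hu : u ∈ S) (hv : v ∈ S) : (plant S H K).adjNat u v = K.adjNat u v := by
  exact SimpleGraph.adjNat_congr (by simp [plant, hu, hv])

open Classical in
theorem adjNat_plant_le (S : Finset (Fin n)) (H K : SimpleGraph (Fin n)) (u v : Fin n) :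
    (plant S H K).adjNat u v ≤ H.adjNat u v + if u ∈ S ∧ v ∈ S then K.adjNat u v else 0 := by
  by_cases h : u ∈ S ∧ v ∈ S
  · rw [adjNat_plant_of_mem h.1 h.2]
    simp [h]
  · simp only [SimpleGraph.adjNat_fin, plant, h, if_false]
    by_cases hH : H.Adj u v
    · simp only [hH, if_true]
      split <;> simp
    · rw [if_neg]
      · exact Nat.zero_le _
      · rintro (⟨h1, h2, _⟩ | ⟨_, h2⟩)
        · exact h ⟨h1, h2⟩
        · exact hH h2

theorem integral_adjNat_le (u v : Fin n) :
    ∫ G : SimpleGraph (Fin n), (G.adjNat u v : ℝ) ∂SimpleGraph.binomialRandom (Fin n) p ≤ p := by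
  by_cases h : u = v
  · subst h
    simp [SimpleGraph.adjNat_fin, p.2.1]
  · exact (SimpleGraph.integral_adjNat h).le

/-- The mean of `adjSum` is at most `n² * p + k² * q ≤ 2 * n² * p`; Markov's inequality with the
factor 20 gives the bound. -/
theorem measureReal_adjSum_ge_le {k : ℕ} {S : Finset (Fin n)} (hS : S.card = k) (hn : 0 < n)
    (hp : 0 < (p : ℝ)) (hpq : (k : ℝ) ^ 2 * q ≤ n ^ 2 * p) :
    ((SimpleGraph.binomialRandom (Fin n) p).prod (SimpleGraph.binomialRandom (Fin n) q)).real
      {HK | 40 * ((n : ℝ) ^ 2 * p) ≤ (plant S HK.1 HK.2).adjSum} ≤ 1 / 20 := by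
  classical
  set μ := SimpleGraph.binomialRandom (Fin n) p
  set ν := SimpleGraph.binomialRandom (Fin n) q
  have h1 := mul_meas_ge_le_integral_of_nonneg (μ := μ.prod ν)
    (f := fun HK => ((plant S HK.1 HK.2).adjSum : ℝ))
    (.of_forall fun _ => Nat.cast_nonneg _) .of_finite (40 * ((n : ℝ) ^ 2 * p))
  have h2 : ∫ HK, ((plant S HK.1 HK.2).adjSum : ℝ) ∂μ.prod ν ≤ n ^ 2 * p + k ^ 2 * q := by
    calc ∫ HK, ((plant S HK.1 HK.2).adjSum : ℝ) ∂μ.prod ν ≤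
          ∫ HK, ((∑ u : Fin n, ∑ v : Fin n, (HK.1.adjNat u v : ℝ)) +
            ∑ u ∈ S, ∑ v ∈ S, (HK.2.adjNat u v : ℝ)) ∂μ.prod ν := by
          refine integral_mono .of_finite .of_finite fun HK => ?_
          have h3 : (plant S HK.1 HK.2).adjSum ≤ (∑ u : Fin n, ∑ v : Fin n, HK.1.adjNat u v) +
              ∑ u ∈ S, ∑ v ∈ S, HK.2.adjNat u v := by
            refine (Finset.sum_le_sum fun u _ => Finset.sum_le_sum fun v _ =>
              adjNat_plant_le S HK.1 HK.2 u v).trans ?_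
            simp_rw [Finset.sum_add_distrib]
            refine Nat.add_le_add_left (le_of_eq ?_) _
            rw [← Finset.sum_subset (Finset.subset_univ S) fun u _ hu => by simp [hu]]
            refine Finset.sum_congr rfl fun u hu => ?_
            simp [hu]
          have h4 := (Nat.cast_le (α := ℝ)).2 h3
          push_cast at h4
          exact h4
      _ = (∫ H, ∑ u : Fin n, ∑ v : Fin n, (H.adjNat u v : ℝ) ∂μ) +
            ∫ K, ∑ u ∈ S, ∑ v ∈ S, (K.adjNat u v : ℝ) ∂ν := by
          rw [integral_add .of_finite .of_finite,
            integral_fun_fst (fun H : SimpleGraph (Fin n) =>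
              ∑ u : Fin n, ∑ v : Fin n, (H.adjNat u v : ℝ)),
            integral_fun_snd (fun K : SimpleGraph (Fin n) => ∑ u ∈ S, ∑ v ∈ S, (K.adjNat u v : ℝ))]
          simp
      _ ≤ (∑ u : Fin n, ∑ v : Fin n, (p : ℝ)) + ∑ u ∈ S, ∑ v ∈ S, (q : ℝ) := by
          refine add_le_add ?_ ?_
          · rw [integral_finsetSum _ fun _ _ => .of_finite]
            refine Finset.sum_le_sum fun u _ => ?_
            rw [integral_finsetSum _ fun _ _ => .of_finite]
            exact Finset.sum_le_sum fun v _ => integral_adjNat_le u v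
          · rw [integral_finsetSum _ fun _ _ => .of_finite]
            refine Finset.sum_le_sum fun u _ => ?_
            rw [integral_finsetSum _ fun _ _ => .of_finite]
            exact Finset.sum_le_sum fun v _ => integral_adjNat_le u v
      _ = n ^ 2 * p + k ^ 2 * q := by
          simp [hS]
          ring
  have h3 : 0 < (n : ℝ) ^ 2 * p := by positivity
  refine le_of_mul_le_mul_left (h1.trans ?_) (show 0 < 40 * ((n : ℝ) ^ 2 * p) by linarith)
  linarith

/-- Label every block that meets `S` by one of its vertices in `S`. At least half of the lower and
half of the upper blocks meet `S`, hence the `m² / 4` pairs. Both `F` and `l` depend on `S` alone,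
so the Chernoff bound applies to the random edges `K` on `F`. -/
theorem exists_labeling_of_countAdj (hm : 0 < m ∧ 2 * m ≤ n) {S : Finset (Fin n)}
    (hS : 2 * (missed m S).card ≤ m) :
    ∃ F : Finset (Fin n × Fin n), (∀ x ∈ F, x.1 < x.2) ∧ m * m ≤ 4 * F.card ∧
      ∃ l, ∀ H K : SimpleGraph (Fin n), K.countAdj F ≤ labelValue (plant S H K) m hm l := by
  classical
  have hL : 0 < n / (2 * m) := Nat.div_pos hm.2 (by omega)
  have hl : ∀ i : Fin (2 * m), ∃ a : Fin (n / (2 * m)), i ∉ missed m S → blockVertex i a ∈ S := by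
    intro i
    by_cases hi : i ∈ missed m S
    · exact ⟨⟨0, hL⟩, fun h => absurd hi h⟩
    · simp only [missed, Finset.mem_filter, Finset.mem_univ, true_and, not_forall, not_not] at hi
      exact ⟨hi.choose, fun _ => hi.choose_spec⟩
  choose l hl using hl
  let lo : Fin m → Fin (2 * m) := fun i => ⟨i, by omega⟩
  let hi : Fin m → Fin (2 * m) := fun i => ⟨m + i, by omega⟩
  have hcard : ∀ φ : Fin m → Fin (2 * m), φ.Injective →
      m ≤ 2 * (Finset.univ.filter fun i => φ i ∉ missed m S).card := by
    intro φ hφ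
    have h1 : (Finset.univ.filter fun i => φ i ∈ missed m S).card ≤ (missed m S).card :=
      Finset.card_le_card_of_injOn φ (by intro i hi; simpa using hi) hφ.injOn
    have h2 := Finset.card_filter_add_card_filter_not (s := (Finset.univ : Finset (Fin m)))
      (fun i => φ i ∈ missed m S)
    simp only [Finset.card_univ, Fintype.card_fin] at h2
    omega
  have hlo : lo.Injective := fun i j h => Fin.ext (by simpa [lo] using h)
  have hhi : hi.Injective := fun i j h => Fin.ext (by simpa [hi] using h)
  let E := (Finset.univ.filter fun i => lo i ∉ missed m S) ×ˢ
    (Finset.univ.filter fun i => hi i ∉ missed m S)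
  let ψ : Fin m × Fin m → Fin n × Fin n := fun x =>
    (blockVertex (lo x.1) (l (lo x.1)), blockVertex (hi x.2) (l (hi x.2)))
  have hψ : ψ.Injective := by
    intro x y hxy
    simp only [ψ, Prod.mk.injEq] at hxy
    exact Prod.ext (hlo (blockVertex_inj hxy.1).1) (hhi (blockVertex_inj hxy.2).1)
  refine ⟨E.image ψ, ?_, ?_, l, fun H K => ?_⟩
  · simp only [Finset.mem_image, forall_exists_index, and_imp, forall_apply_eq_imp_iff₂]
    intro x _
    simp only [ψ, blockVertex, Fin.mk_lt_mk]
    exact blockVertex_lt_blockVertex (by simp only [lo, hi]; omega) (Fin.is_lt _)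
  · rw [Finset.card_image_of_injective _ hψ, Finset.card_product]
    have := Nat.mul_le_mul (hcard lo hlo) (hcard hi hhi)
    linarith
  · rw [SimpleGraph.countAdj, Finset.sum_image hψ.injOn]
    have h1 : labelValue (plant S H K) m hm l =
        ∑ x : Fin m × Fin m, (plant S H K).adjNat (ψ x).1 (ψ x).2 := by
      rw [labelValue, ← finProdFinEquiv.sum_comp]
      refine Finset.sum_congr rfl fun x _ => ?_
      have h2 : (finProdFinEquiv x : ℕ) / m = x.1 := by
        rw [finProdFinEquiv_apply_val, Nat.add_mul_div_left _ _ hm.1, Nat.div_eq_of_lt x.2.2,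
          zero_add]
      have h3 : (finProdFinEquiv x : ℕ) % m = x.2 := by
        rw [finProdFinEquiv_apply_val, Nat.add_mul_mod_self_left, Nat.mod_eq_of_lt x.2.2]
      simp only [edgeRound, ψ, blockVertex, lo, hi, h2, h3]
    rw [h1]
    refine le_trans (le_of_eq ?_) (Finset.sum_le_sum_of_subset (Finset.subset_univ E))
    refine Finset.sum_congr rfl fun x hx => ?_
    simp only [E, Finset.mem_product, Finset.mem_filter, Finset.mem_univ, true_and] at hx
    exact (adjNat_plant_of_mem (hl _ hx.1) (hl _ hx.2)).symm

theorem measureReal_labelValue_lt_le (hm : 0 < m ∧ 2 * m ≤ n) {S : Finset (Fin n)}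
    (hS : 2 * (missed m S).card ≤ m) :
    ((SimpleGraph.binomialRandom (Fin n) p).prod (SimpleGraph.binomialRandom (Fin n) q)).real
      {HK | ¬ ∃ l, (q * (m * m) / 16 : ℝ) ≤ labelValue (plant S HK.1 HK.2) m hm l} ≤
      Real.exp (-(q * (m * m) / 16)) := by
  obtain ⟨F, hF, hcard, l, hl⟩ := exists_labeling_of_countAdj hm hS
  have hq : 0 ≤ (q : ℝ) := q.2.1
  have h1 : (m * m : ℝ) ≤ 4 * F.card := by exact_mod_cast hcard
  have h2 : (q * (m * m) / 16 : ℝ) ≤ q * F.card / 4 := by nlinarith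
  have hsub : {HK : SimpleGraph (Fin n) × SimpleGraph (Fin n) |
      ¬ ∃ l, (q * (m * m) / 16 : ℝ) ≤ labelValue (plant S HK.1 HK.2) m hm l} ⊆
      Set.univ ×ˢ {K | (K.countAdj F : ℝ) ≤ q * F.card / 4} := by
    rintro ⟨H, K⟩ hHK
    refine ⟨trivial, ?_⟩
    by_contra hK
    refine hHK ⟨l, ?_⟩
    have : (K.countAdj F : ℝ) ≤ labelValue (plant S H K) m hm l := by exact_mod_cast hl H K
    simp only [Set.mem_ofPred_eq, not_le] at hK
    linarith
  refine (measureReal_mono hsub).trans ?_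
  rw [measureReal_prod_prod, probReal_univ, one_mul]
  refine (SimpleGraph.measureReal_countAdj_le F hF).trans (Real.exp_le_exp.2 ?_)
  linarith

theorem plantedRandom_real_apply {k : ℕ} (B : Set (SimpleGraph (Fin n))) :
    (plantedRandom n p k q).real B = (n.choose k : ℝ)⁻¹ *
      ∑ S ∈ Finset.powersetCard k Finset.univ,
        ((SimpleGraph.binomialRandom (Fin n) p).prod (SimpleGraph.binomialRandom (Fin n) q)).real
          {HK | plant S HK.1 HK.2 ∈ B} := by
  rw [plantedRandom, measureReal_ennreal_smul_apply, ENNReal.toReal_inv, ENNReal.toReal_natCast,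
    measureReal_def, Measure.finsetSum_apply, ENNReal.toReal_sum fun _ _ => ?_]
  · congr 1
    refine Finset.sum_congr rfl fun S _ => ?_
    rw [Measure.map_apply .of_discrete (Set.toFinite B).measurableSet]
    rfl
  · rw [Measure.map_apply .of_discrete (Set.toFinite B).measurableSet]
    exact measure_ne_top _ _

theorem isProbabilityMeasure_plantedRandom {k : ℕ} (hk : k ≤ n) :
    IsProbabilityMeasure (plantedRandom n p k q) := by
  have hC : (n.choose k : ℝ) ≠ 0 := by exact_mod_cast (Nat.choose_pos hk).ne'
  have h1 : (plantedRandom n p k q).real Set.univ = 1 := by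
    rw [plantedRandom_real_apply]
    simp [hC]
  exact ⟨(ENNReal.toReal_eq_one_iff _).1 h1⟩

/-- Outside of these graphs, the learner distinguishes. -/
theorem plantedRandom_real_bad_le (hm : 0 < m ∧ 2 * m ≤ n) {k : ℕ} (hk : k ≤ n)
    (hp : 0 < (p : ℝ)) (hpq : (k : ℝ) ^ 2 * q ≤ n ^ 2 * p) (hkL : 10 * n ≤ k * (n / (2 * m)))
    (hq : 96 ≤ q * (m * m : ℝ)) :
    (plantedRandom n p k q).real
      {G | ¬ ((G.adjSum : ℝ) ≤ 40 * (n ^ 2 * p) ∧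
        ∃ l, (q * (m * m) / 16 : ℝ) ≤ labelValue G m hm l)} ≤ 9 / 80 := by
  classical
  have hC : (0 : ℝ) < n.choose k := by exact_mod_cast Nat.choose_pos hk
  rw [plantedRandom_real_apply, inv_mul_le_iff₀ hC]
  -- The indicator charges the sets that miss too many blocks, `1 / 20` the graphs with too many
  -- edges, and `1 / 80` the graphs with too few planted edges on the chosen pairs.
  have h1 : ∀ S ∈ Finset.powersetCard k (Finset.univ : Finset (Fin n)),
      ((SimpleGraph.binomialRandom (Fin n) p).prod (SimpleGraph.binomialRandom (Fin n) q)).real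
        {HK | plant S HK.1 HK.2 ∈ {G | ¬ ((G.adjSum : ℝ) ≤ 40 * (n ^ 2 * p) ∧
          ∃ l, (q * (m * m) / 16 : ℝ) ≤ labelValue G m hm l)}} ≤
      (1 / 20 + 1 / 80) + if m < 2 * (missed m S).card then 1 else 0 := by
    intro S hS
    split_ifs with h
    · exact measureReal_le_one.trans (by norm_num)
    · rw [add_zero]
      refine (measureReal_mono (s₂ := {HK | 40 * ((n : ℝ) ^ 2 * p) ≤ (plant S HK.1 HK.2).adjSum} ∪
        {HK | ¬ ∃ l, (q * (m * m) / 16 : ℝ) ≤ labelValue (plant S HK.1 HK.2) m hm l}) ?_).trans ?_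
      · intro HK hHK
        simp only [Set.mem_ofPred_eq, not_and_or, not_le] at hHK
        exact hHK.imp (fun h => h.le) id
      · refine (measureReal_union_le _ _).trans (add_le_add ?_ ?_)
        · exact measureReal_adjSum_ge_le (Finset.mem_powersetCard.1 hS).2 (by omega) hp hpq
        · refine (measureReal_labelValue_lt_le hm (by omega)).trans ?_
          exact (Real.exp_le_exp.2 (by linarith)).trans Learner.exp_neg_six_le
  refine (Finset.sum_le_sum h1).trans ?_
  rw [Finset.sum_add_distrib, Finset.sum_boole, Finset.sum_const, Finset.card_powersetCard,
    Finset.card_univ, Fintype.card_fin, nsmul_eq_mul]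
  have := card_many_missed_le hm.1 hm.2 hkL
  linarith

end Planted

/-! ### The error probabilities of the distinguisher -/

namespace Learner
variable (A : Learner) {n m : ℕ} {p q : unitInterval}

/-- The mean gain exceeds `q * m² / 128` except with small probability. Half of this covers the
density term, at most `640 * p * m²`, where `163840 = 256 * 640`; the other half covers the margin
`3 * m`, where `768 = 256 * 3`. -/
theorem uniformOn_not_exceeds_le {Q : ℕ} {G : SimpleGraph (Fin n)} (hm : 0 < m ∧ 2 * m ≤ n)
    (hQ : n * A.blockCoins n m ≤ Q) (hadj : (G.adjSum : ℝ) ≤ 40 * (n ^ 2 * p))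
    (hl : ∃ l, (q * (m * m) / 16 : ℝ) ≤ labelValue G m hm l)
    (hreg : A.regret (blockGame n m hm) (edgeRound G m hm) ≤ q * (m * m) / 32)
    (hpq : 163840 * (p : ℝ) ≤ q) (hq : 768 ≤ (q * m : ℝ)) :
    (ProbabilityTheory.uniformOn Set.univ).real {r : Fin Q → Bool | ¬ ∃ x, A.Exceeds G r x} ≤
      1 / 19 := by
  obtain ⟨l, hl⟩ := hl
  have hm0 : (0 : ℝ) < m := by exact_mod_cast hm.1
  have hmn : (2 * m : ℝ) ≤ n := by exact_mod_cast hm.2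
  have hq0 : (0 : ℝ) ≤ q := q.2.1
  have hreg' : A.regret (blockGame n m hm) (edgeRound G m hm) ≤ (q * (m * m) / 16 : ℝ) / 2 :=
    hreg.trans (le_of_eq (by ring))
  have h1 := A.uniformOn_totalGain_le hQ hl hreg'
  have hsub : {r : Fin Q → Bool | ¬ ∃ x, A.Exceeds G r x} ⊆
      {r | (A.totalGain G m hm r : ℝ) ≤ n * (q * (m * m) / 16) / 8} := by
    intro r hr
    by_contra hlt
    simp only [Set.mem_ofPred_eq, not_le] at hlt
    obtain ⟨m, rfl⟩ : ∃ m', m = m' + 1 := ⟨m - 1, by omega⟩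
    refine hr ⟨⟨m, by omega⟩, ?_⟩
    have h2 : (16 * G.adjSum * ((m + 1 : ℕ) * (m + 1 : ℕ)) + 3 * (m + 1 : ℕ) * (n * n) : ℝ) ≤
        n * A.totalGain G (m + 1) hm r := by
      generalize ((m + 1 : ℕ) : ℝ) = x at *
      have h3 : (n : ℝ) * (n * (q * (x * x) / 16) / 8) ≤ n * A.totalGain G (m + 1) hm r :=
        mul_le_mul_of_nonneg_left hlt.le (Nat.cast_nonneg _)
      refine le_trans ?_ h3
      have h4 : 16 * (G.adjSum : ℝ) * (x * x) ≤ 16 * (40 * (n ^ 2 * (q / 163840))) * (x * x) := by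
        refine mul_le_mul_of_nonneg_right ?_ (by positivity)
        refine mul_le_mul_of_nonneg_left (hadj.trans ?_) (by norm_num)
        refine mul_le_mul_of_nonneg_left ?_ (by norm_num)
        refine mul_le_mul_of_nonneg_left ?_ (by positivity)
        linarith
      have h5 : 3 * x * ((n : ℝ) * n) ≤ (q * x / 256) * x * (n * n) := by
        have : 3 ≤ q * x / 256 := by linarith
        refine mul_le_mul_of_nonneg_right ?_ (by positivity)
        exact mul_le_mul_of_nonneg_right this hm0.le
      refine (add_le_add h4 h5).trans (le_of_eq ?_)
      ring
    unfold Exceeds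
    exact_mod_cast h2
  refine (measureReal_mono hsub).trans (h1.trans ?_)
  refine (Real.exp_le_exp.2 ?_).trans exp_neg_three_le
  have h2 : (n * (q * (m * m) / 16) / (8 * (m * m)) : ℝ) = n * q / 128 := by
    field_simp
    ring
  rw [h2]
  nlinarith

/-- Each of `2 * m` and `n / (2 * m)` is at most `n`, and `m * m ≤ n ^ 2`, whence the argument `n ^
2 + 3 * n` in `distinguisherCoins`. -/
theorem mul_blockCoins_le (hm : 0 < m ∧ 2 * m ≤ n) :
    n * A.blockCoins n m ≤ A.distinguisherCoins.eval n := by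
  simp only [distinguisherCoins, blockCoins, Polynomial.eval_mul, Polynomial.eval_X,
    Polynomial.eval_comp, Polynomial.eval_add, Polynomial.eval_pow, Polynomial.eval_ofNat]
  refine Nat.mul_le_mul_left _ (Polynomial.eval_nat_mono _ ?_)
  have h1 : m * m ≤ n ^ 2 := by nlinarith
  have h2 := Nat.div_le_self n (2 * m)
  omega

end Learner

/-- Used in the null model, where the error is bounded for each fixed sequence of coins. -/
theorem prod_real_le_of_forall {α β : Type*} [MeasurableSpace α] [MeasurableSpace β] {μ : Measure α}
    {ν : Measure β} [IsProbabilityMeasure μ] [IsProbabilityMeasure ν] {s : Set (α × β)}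
    (hs : MeasurableSet s) {c : ℝ} (hc : 0 ≤ c) (h : ∀ y, μ.real {x | (x, y) ∈ s} ≤ c) :
    (μ.prod ν).real s ≤ c := by
  refine ENNReal.toReal_le_of_le_ofReal hc ?_
  rw [Measure.prod_apply_symm hs]
  calc ∫⁻ y, μ ((fun x => (x, y)) ⁻¹' s) ∂ν ≤ ∫⁻ _, ENNReal.ofReal c ∂ν :=
        lintegral_mono fun y => (ENNReal.le_ofReal_iff_toReal_le (measure_ne_top _ _) hc).2 (h y)
    _ = ENNReal.ofReal c := by simp

/-- Used in the planted model, where the error over the coins is bounded for each graph outside a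
bad set `t`. -/
theorem prod_real_le_add_of_forall {α β : Type*} [MeasurableSpace α] [MeasurableSpace β]
    {μ : Measure α} {ν : Measure β} [IsProbabilityMeasure μ] [IsProbabilityMeasure ν]
    {s : Set (α × β)} (hs : MeasurableSet s) {t : Set α} (ht : MeasurableSet t) {c : ℝ} (hc : 0 ≤ c)
    (h : ∀ x ∉ t, ν.real {y | (x, y) ∈ s} ≤ c) : (μ.prod ν).real s ≤ μ.real t + c := by
  have h1 : (μ.prod ν).real (s \ t ×ˢ Set.univ) ≤ c := by
    refine ENNReal.toReal_le_of_le_ofReal hc ?_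
    rw [Measure.prod_apply (hs.diff (ht.prod .univ))]
    calc ∫⁻ x, ν (Prod.mk x ⁻¹' (s \ t ×ˢ Set.univ)) ∂μ ≤ ∫⁻ _, ENNReal.ofReal c ∂μ := by
          refine lintegral_mono fun x => ?_
          by_cases hx : x ∈ t
          · have : Prod.mk x ⁻¹' (s \ t ×ˢ Set.univ) = ∅ := by
              ext y
              simp [hx]
            simp [this]
          · refine (measure_mono fun y hy => hy.1).trans
              ((ENNReal.le_ofReal_iff_toReal_le (measure_ne_top _ _) hc).2 (h x hx))
      _ = ENNReal.ofReal c := by simp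
  calc (μ.prod ν).real s ≤ (μ.prod ν).real (t ×ˢ Set.univ ∪ s \ t ×ˢ Set.univ) :=
        measureReal_mono fun x hx => by
          by_cases h : x ∈ t ×ˢ (Set.univ : Set β)
          · exact Or.inl h
          · exact Or.inr ⟨hx, h⟩
    _ ≤ (μ.prod ν).real (t ×ˢ Set.univ) + (μ.prod ν).real (s \ t ×ˢ Set.univ) :=
        measureReal_union_le _ _
    _ ≤ μ.real t + c := by
        rw [measureReal_prod_prod, probReal_univ, mul_one]
        linarith

namespace Distinguisher
variable (D : Distinguisher) {n : ℕ}

theorem answerProb_add_answerProb_not {μ : Measure (SimpleGraph (Fin n))} [IsProbabilityMeasure μ]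
    (b : Bool) : D.answerProb μ b + D.answerProb μ (!b) = 1 := by
  unfold answerProb
  have h : {x : SimpleGraph (Fin n) × (Fin (D.coins.eval n) → Bool) | D.verdict n x.1 x.2 = !b} =
      {x | D.verdict n x.1 x.2 = b}ᶜ := by
    ext x
    simp only [Set.mem_ofPred_eq, Set.mem_compl_iff]
    cases b <;> simp
  rw [h]
  exact probReal_add_probReal_compl (Set.toFinite _).measurableSet

end Distinguisher

section Finitary
variable {A : Learner} {D : Distinguisher} {n m : ℕ} {p q : unitInterval}

open Classical in
theorem answerProb_binomialRandom_ge
    (hD : ∀ n (G : SimpleGraph (Fin n)) r, D.verdict n G r = decide (∃ x, A.Exceeds G r x))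
    (hn : 2 ≤ n) (hp : 24 ≤ p * ((n : ℝ) * (n - 1))) :
    4 / 5 ≤ D.answerProb (SimpleGraph.binomialRandom (Fin n) p) false := by
  have h1 := D.answerProb_add_answerProb_not (μ := SimpleGraph.binomialRandom (Fin n) p) false
  have h2 : D.answerProb (SimpleGraph.binomialRandom (Fin n) p) true ≤ 1 / 5 := by
    refine prod_real_le_of_forall (Set.toFinite _).measurableSet (by norm_num) fun r => ?_
    simpa [hD] using A.measureReal_exceeds_le r hn hp
  simp only [Bool.not_false] at h1
  linarith

open Classical in
theorem answerProb_plantedRandom_ge (hcoins : D.coins = A.distinguisherCoins)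
    (hD : ∀ n (G : SimpleGraph (Fin n)) r, D.verdict n G r = decide (∃ x, A.Exceeds G r x))
    (hm : 0 < m ∧ 2 * m ≤ n) {k : ℕ} (hk : k ≤ n)
    (hp : 0 < (p : ℝ)) (hkn : (k : ℝ) ^ 2 * q ≤ n ^ 2 * p) (hkL : 10 * n ≤ k * (n / (2 * m)))
    (hpq : 163840 * (p : ℝ) ≤ q) (hq : 768 ≤ (q * m : ℝ))
    (hreg : ∀ σ, A.regret (blockGame n m hm) σ ≤ q * (m * m) / 32) :
    4 / 5 ≤ D.answerProb (plantedRandom n p k q) true := by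
  have := isProbabilityMeasure_plantedRandom (p := p) (q := q) hk
  have h1 := D.answerProb_add_answerProb_not (μ := plantedRandom n p k q) false
  have hm1 : (1 : ℝ) ≤ m := by exact_mod_cast hm.1
  have h2 := plantedRandom_real_bad_le (p := p) (q := q) hm hk hp hkn hkL (by nlinarith)
  have h3 : D.answerProb (plantedRandom n p k q) false ≤
      (plantedRandom n p k q).real {G | ¬ ((G.adjSum : ℝ) ≤ 40 * (n ^ 2 * p) ∧
        ∃ l, (q * (m * m) / 16 : ℝ) ≤ labelValue G m hm l)} + 1 / 19 := by
    refine prod_real_le_add_of_forall (Set.toFinite _).measurableSet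
      (Set.toFinite _).measurableSet (by norm_num) fun G hG => ?_
    simp only [Set.mem_ofPred_eq, not_not] at hG
    have := A.uniformOn_not_exceeds_le hm (hcoins ▸ A.mul_blockCoins_le hm) hG.1 hG.2
      (hreg (edgeRound G m hm)) hpq hq
    simpa [hD] using this
  simp only [Bool.not_false] at h1
  linarith

end Finitary

/-! ### A lower bound for the regret -/

/-- The learner cannot guess the sign of the payoffs of a single round. -/
theorem Learner.exists_one_le_regret (A : Learner) (s : GameSize) (hi : 2 ≤ s.items)
    (hL : 2 ≤ s.labels) (hr : s.rounds = 1) : ∃ σ, 1 ≤ A.regret s σ := by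
  obtain ⟨N, i, L, T, hL0⟩ := s
  simp only at hi hL hr
  subst hr
  let R : ℚ → Round i L := fun c =>
    { fst := ⟨0, by omega⟩
      snd := ⟨1, by omega⟩
      distinct := by simp
      -- Label 0 earns `c` and every other label `-c`. Clamping makes `bounded` hold for all `c`;
      -- only `c = 1` and `c = -1` matter, and these give opposite payoffs to every answer.
      payoff := fun a _ => max (-1) (min 1 (if (a : ℕ) = 0 then c else -c))
      bounded := fun a b => by
        rw [abs_le]
        exact ⟨le_max_left _ _, max_le (by norm_num) (min_le_left _ _)⟩ }
  have hopt : ∀ c : ℚ, c = 1 ∨ c = -1 → 1 ≤ opt (fun _ : Fin 1 => R c) := by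
    intro c hc
    refine le_trans ?_ (le_ciSup (Set.finite_range _).bddAbove
      (fun _ => if c = 1 then (⟨0, by omega⟩ : Fin L) else ⟨1, by omega⟩))
    rcases hc with rfl | rfl <;> simp [R]; norm_num
  have hsum : A.expectedPayoff ⟨N, i, L, 1, hL0⟩ (fun _ => R 1) +
      A.expectedPayoff ⟨N, i, L, 1, hL0⟩ (fun _ => R (-1)) = 0 := by
    unfold expectedPayoff
    rw [← Finset.expect_add_distrib]
    refine Finset.expect_eq_zero fun r _ => ?_
    simp only [Finset.univ_unique, Finset.sum_singleton, Fin.default_eq_zero, Fin.val_zero,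
      List.take_zero, R]
    split_ifs with h0 <;> simp [h0]
  by_contra! h
  have h1 := h fun _ => R 1
  have h2 := h fun _ => R (-1)
  have h3 := hopt 1 (Or.inl rfl)
  have h4 := hopt (-1) (Or.inr rfl)
  unfold regret at h1 h2
  linarith

/-! ### The choice of the parameters -/

/-- The size of `L ^ β` for the exponent `β` of the theorem and a number of labels `L` that is
`n ^ (1 / 2 + ε')` up to a constant factor. -/
theorem labels_rpow_le {n L k q a e δ : ℝ} (hn : 1 < n) (he : 0 < e) (he' : e < 1 / 2) (ha : 0 ≤ a)
    (hδ : 0 ≤ δ) (hk : 1 ≤ k) (hkn : k ≤ n ^ e) (hnk : n ^ e ≤ 2 * k) (hq : q = k ^ (-a))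
    (hL : n ^ (1 - e) ≤ L) (hL' : L ≤ 80 * n ^ (1 - e)) :
    L ^ (2 * ((1 / 2 - e * a - δ) / (1 - e)) - 1) ≤ 160 * (k * q ^ 2 * n ^ (-(2 * δ))) := by
  have hn0 : 0 < n := by linarith
  set β := 2 * ((1 / 2 - e * a - δ) / (1 - e)) - 1 with hβ
  have hβ1 : β ≤ 1 := by
    have : (1 / 2 - e * a - δ) / (1 - e) ≤ 1 := by
      rw [div_le_one (by linarith)]
      nlinarith [mul_nonneg he.le ha]
    linarith
  have hΛ : 0 < n ^ (1 - e) := Real.rpow_pos_of_pos hn0 _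
  -- The sign of `β` is unknown: for `β ≥ 0` the upper bound on `L` is used together with `β ≤ 1`,
  -- for `β ≤ 0` the lower bound.
  have h1 : L ^ β ≤ 80 * (n ^ (1 - e)) ^ β := by
    rcases le_total 0 β with h | h
    · calc L ^ β ≤ (80 * n ^ (1 - e)) ^ β := Real.rpow_le_rpow (hΛ.le.trans hL) hL' h
        _ = 80 ^ β * (n ^ (1 - e)) ^ β := Real.mul_rpow (by norm_num) hΛ.le
        _ ≤ 80 * (n ^ (1 - e)) ^ β := by
            refine mul_le_mul_of_nonneg_right ?_ (Real.rpow_nonneg hΛ.le _)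
            calc (80 : ℝ) ^ β ≤ 80 ^ (1 : ℝ) := Real.rpow_le_rpow_of_exponent_le (by norm_num) hβ1
              _ = 80 := Real.rpow_one _
    · have h2 : L ^ β ≤ (n ^ (1 - e)) ^ β := Real.rpow_le_rpow_of_nonpos hΛ hL h
      have h3 : 0 ≤ (n ^ (1 - e)) ^ β := Real.rpow_nonneg hΛ.le _
      linarith
  -- The definition of `β` amounts to `(1 - e) * β = e - 2 * e * a - 2 * δ`.
  have h2 : (n ^ (1 - e)) ^ β = n ^ e * (n ^ e) ^ (-(2 * a)) * n ^ (-(2 * δ)) := by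
    rw [← Real.rpow_mul hn0.le, ← Real.rpow_mul hn0.le, ← Real.rpow_add hn0, ← Real.rpow_add hn0]
    congr 1
    have : 1 - e ≠ 0 := by linarith
    rw [hβ]
    field_simp
    ring
  have h3 : (n ^ e) ^ (-(2 * a)) ≤ q ^ 2 := by
    have : q ^ 2 = k ^ (-(2 * a)) := by
      rw [hq, ← Real.rpow_natCast, ← Real.rpow_mul (by linarith)]
      congr 1
      push_cast
      ring
    rw [this]
    exact Real.rpow_le_rpow_of_nonpos (by linarith) hkn (by linarith)
  have h4 : n ^ e * (n ^ e) ^ (-(2 * a)) ≤ 2 * k * q ^ 2 :=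
    mul_le_mul hnk h3 (Real.rpow_nonneg (Real.rpow_nonneg hn0.le _) _) (by linarith)
  have h5 : 0 ≤ n ^ (-(2 * δ)) := Real.rpow_nonneg hn0.le _
  have h6 := mul_le_mul_of_nonneg_right h4 h5
  rw [h2] at h1
  linarith

/-- Natural numbers `m ≈ k / 40` of blocks and `L ≈ 20 n / k` of labels. -/
theorem block_sizes {n k : ℕ} (hk : 80 ≤ k) (hkn : k ≤ n) :
    (k : ℝ) ≤ 80 * (k / 40 : ℕ) ∧ 10 * (n / k : ℝ) ≤ (n / (2 * (k / 40)) : ℕ) ∧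
      ((n / (2 * (k / 40)) : ℕ) : ℝ) ≤ 40 * (n / k) := by
  have hm : k ≤ 80 * (k / 40) := by omega
  have hm' : 40 * (k / 40) ≤ k := by omega
  generalize k / 40 = m at *
  have hk0 : (0 : ℝ) < k := by exact_mod_cast (by omega : 0 < k)
  have hm0 : (0 : ℝ) < m := by exact_mod_cast (by omega : 0 < m)
  have h1 : (k : ℝ) ≤ 80 * m := by exact_mod_cast hm
  have h2 : (40 * m : ℝ) ≤ k := by exact_mod_cast hm'
  have h3 : (k : ℝ) ≤ n := by exact_mod_cast hkn
  refine ⟨h1, ?_, ?_⟩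
  -- Before rounding there are at least `20 * n / k` labels; rounding down a number that is at least
  -- 1 loses at most a factor 2.
  · have h4 : n < (n / (2 * m) + 1) * (2 * m) :=
      Nat.lt_mul_of_div_lt (Nat.lt_succ_self _) (by omega)
    have h5 : (n : ℝ) < ((n / (2 * m) : ℕ) + 1) * (2 * m) := by exact_mod_cast h4
    rw [mul_div_assoc', div_le_iff₀ hk0]
    have h6 : (1 : ℝ) ≤ (n / (2 * m) : ℕ) := by
      exact_mod_cast Nat.div_pos (by omega : 2 * m ≤ n) (by omega)
    nlinarith
  · have h4 : (n / (2 * m)) * (2 * m) ≤ n := Nat.div_mul_le_self _ _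
    have h5 : ((n / (2 * m) : ℕ) * (2 * m) : ℝ) ≤ n := by exact_mod_cast h4
    rw [mul_div_assoc', le_div_iff₀ hk0]
    have h6 : (0 : ℝ) ≤ (n / (2 * m) : ℕ) := by positivity
    nlinarith

/-- If `L ^ β` is small enough compared with `k q²`, but not smaller than a constant, then the
planted edges outweigh the regret. -/
theorem regret_bounds {C k q η m Lβ : ℝ} (hC : 1 ≤ C) (hk : 61440 ^ 2 ≤ k) (hq : 0 ≤ q)
    (hη : 26214400 * C ^ 2 * η ≤ 1) (hm : k ≤ 80 * m)
    (hLβ : Lβ ≤ 160 * (k * q ^ 2 * η)) (hone : 1 ≤ C * √(2 * Lβ * 1)) :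
    768 ≤ q * m ∧ C * √(2 * m * Lβ * (m * m)) ≤ q * (m * m) / 32 := by
  have hm0 : 0 < m := by linarith
  have hkq : 0 ≤ k * q ^ 2 := by positivity
  constructor
  -- A negative argument would make the square root 0, against `hone`. Then `hone` yields `k * q² ≥
  -- 1`, so `(q * k)² ≥ k ≥ 61440²`, where `61440 = 80 * 768`.
  · have hL0 : 0 ≤ 2 * Lβ * 1 := by
      by_contra h
      rw [Real.sqrt_eq_zero_of_nonpos (not_le.1 h).le] at hone
      linarith
    have h1 : 1 ≤ C ^ 2 * (2 * Lβ) := by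
      calc (1 : ℝ) ≤ (C * √(2 * Lβ * 1)) ^ 2 := by nlinarith
        _ = C ^ 2 * (2 * Lβ) := by rw [mul_pow, Real.sq_sqrt hL0, mul_one]
    have h2 : C ^ 2 * (2 * Lβ) ≤ C ^ 2 * (320 * (k * q ^ 2 * η)) :=
      mul_le_mul_of_nonneg_left (by linarith) (by positivity)
    have h3 : 1 ≤ k * q ^ 2 := by
      have := mul_le_mul_of_nonneg_left hη hkq
      nlinarith
    have h4 : 61440 ≤ q * k := by
      refine le_of_sq_le_sq ?_ (by positivity)
      nlinarith
    nlinarith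
  · have h1 : 0 ≤ q * (m * m) / 32 := by positivity
    have h2 : (2 * m * Lβ * (m * m)) ≤ (q * (m * m) / 32 / C) ^ 2 := by
      -- Here `26214400 = 320 * 80 * 32²`, with 320 from the regret, 80 from `k ≤ 80 * m` and 32
      -- from the target.
      have h3 : C ^ 2 * η * 26214400 * k ≤ 80 * m := by nlinarith
      rw [div_pow, le_div_iff₀ (by positivity)]
      calc 2 * m * Lβ * (m * m) * C ^ 2 ≤
            2 * m * (160 * (k * q ^ 2 * η)) * (m * m) * C ^ 2 := by gcongr
        _ = (C ^ 2 * η * 26214400 * k) * (q ^ 2 * m ^ 3 / 81920) := by ring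
        _ ≤ (80 * m) * (q ^ 2 * m ^ 3 / 81920) := by gcongr
        _ = (q * (m * m) / 32) ^ 2 := by ring
    have h3 : √(2 * m * Lβ * (m * m)) ≤ q * (m * m) / 32 / C :=
      Real.sqrt_le_iff.2 ⟨by positivity, h2⟩
    rw [le_div_iff₀ (by linarith)] at h3
    linarith

open Classical in
/-- The statement for a single large `n`. -/
theorem answerProb_ge_of_regret_le {A : Learner} {D : Distinguisher}
    (hcoins : D.coins = A.distinguisherCoins)
    (hD : ∀ n (G : SimpleGraph (Fin n)) r, D.verdict n G r = decide (∃ x, A.Exceeds G r x))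
    {n k : ℕ} {p q : unitInterval} {α ε ε' δ C : ℝ} (hα : 0 ≤ α) (hα' : α ≤ 1 / 2) (hε : 0 ≤ ε)
    (hε' : 0 < ε') (hδ : 0 ≤ δ) (hk : k = ⌊(n : ℝ) ^ (1 / 2 - ε')⌋₊) (hk' : 61440 ^ 2 ≤ k)
    (hp : (p : ℝ) = (n : ℝ) ^ (-α)) (hq : (q : ℝ) = (k : ℝ) ^ (-α - ε))
    (hpq : 163840 * (p : ℝ) ≤ q) (hC : 1 ≤ C)
    (hη : 26214400 * C ^ 2 * (n : ℝ) ^ (-(2 * δ)) ≤ 1)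
    (hA : ∀ s : GameSize, s.scale = n → s.items ≤ n → s.labels ≤ n → s.rounds ≤ n ^ 2 →
      ∀ σ : Fin s.rounds → Round s.items s.labels, A.regret s σ ≤ C * √((s.items : ℝ) *
        (s.labels : ℝ) ^ (2 * ((1 / 2 - (1 / 2 - ε') * (α + ε) - δ) / (1 / 2 + ε')) - 1) *
        (s.rounds : ℝ))) :
    4 / 5 ≤ D.answerProb (SimpleGraph.binomialRandom (Fin n) p) false ∧
      4 / 5 ≤ D.answerProb (plantedRandom n p k q) true := by
  have hk1 : (61440 ^ 2 : ℝ) ≤ k := by exact_mod_cast hk'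
  have hkn : (k : ℝ) ≤ (n : ℝ) ^ (1 / 2 - ε') := by
    rw [hk]
    exact Nat.floor_le (Real.rpow_nonneg (Nat.cast_nonneg _) _)
  have hnk : (n : ℝ) ^ (1 / 2 - ε') ≤ 2 * k := by
    have := (Nat.lt_floor_add_one ((n : ℝ) ^ (1 / 2 - ε'))).le
    rw [← hk] at this
    linarith
  have hn1 : (1 : ℝ) < n := by
    have h0 : n ≠ 0 := by
      rintro rfl
      have := Real.zero_rpow_le_one (1 / 2 - ε')
      rw [Nat.cast_zero] at hkn
      linarith
    have h1 : n ≠ 1 := by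
      rintro rfl
      rw [Nat.cast_one, Real.one_rpow] at hkn
      linarith
    exact_mod_cast (by omega : 1 < n)
  have hn0 : (0 : ℝ) < n := by linarith
  have he : 0 < 1 / 2 - ε' := by
    by_contra h
    have := Real.rpow_le_one_of_one_le_of_nonpos hn1.le (not_lt.1 h)
    linarith
  have hk2 : (k : ℝ) ^ 2 ≤ n := by
    have h1 : (k : ℝ) ≤ (n : ℝ) ^ (1 / 2 : ℝ) :=
      hkn.trans (Real.rpow_le_rpow_of_exponent_le hn1.le (by linarith))
    rw [← Real.sqrt_eq_rpow] at h1
    calc (k : ℝ) ^ 2 ≤ √(n : ℝ) ^ 2 := pow_le_pow_left₀ (Nat.cast_nonneg _) h1 2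
      _ = n := Real.sq_sqrt hn0.le
  have hkn' : (k : ℝ) ≤ n := (le_self_pow₀ (by linarith) two_ne_zero).trans hk2
  have hkn'' : k ≤ n := by exact_mod_cast hkn'
  -- The bound `α ≤ 1 / 2` enters here; with `k² ≤ n` it gives `k² * q ≤ n² * p`, so that planting
  -- does not change the order of the edge count.
  have hpn : 1 ≤ p * (n : ℝ) := by
    rw [hp]
    nth_rw 2 [← Real.rpow_one (n : ℝ)]
    rw [← Real.rpow_add hn0]
    exact Real.one_le_rpow hn1.le (by linarith)
  have hp0 : 0 < (p : ℝ) := by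
    rw [hp]
    exact Real.rpow_pos_of_pos hn0 _
  obtain ⟨hkm, hL, hL'⟩ := block_sizes (by omega) hkn''
  set m := k / 40 with hm
  set L := n / (2 * m) with hLdef
  have hm0 : 0 < m := by omega
  have hmn : 2 * m ≤ n := by omega
  have hnke : (n : ℝ) ^ (1 - (1 / 2 - ε')) ≤ n / k := by
    rw [le_div_iff₀ (by linarith), Real.rpow_sub hn0, Real.rpow_one, div_mul_eq_mul_div,
      div_le_iff₀ (Real.rpow_pos_of_pos hn0 _)]
    exact mul_le_mul_of_nonneg_left hkn hn0.le
  have hnke' : (n / k : ℝ) ≤ 2 * (n : ℝ) ^ (1 - (1 / 2 - ε')) := by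
    rw [div_le_iff₀ (by linarith), Real.rpow_sub hn0, Real.rpow_one, mul_div_assoc',
      div_mul_eq_mul_div, le_div_iff₀ (Real.rpow_pos_of_pos hn0 _)]
    exact mul_le_mul_of_nonneg_left hnk hn0.le |>.trans (le_of_eq (by ring))
  have hnk0 : 1 ≤ (n / k : ℝ) := by
    rw [le_div_iff₀ (by linarith)]
    linarith
  have hβ := labels_rpow_le (L := L) (q := q) (a := α + ε) hn1 he (by linarith) (by linarith) hδ
    (by linarith) hkn hnk (by rw [hq]; congr 1; ring) (by linarith) (by linarith)
  have he2 : 1 - (1 / 2 - ε') = 1 / 2 + ε' := by ring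
  rw [he2] at hβ
  have hL2 : 2 ≤ L := by
    have : (2 : ℝ) ≤ L := by linarith
    exact_mod_cast this
  have hLn : L ≤ n := Nat.div_le_self _ _
  -- One round on two items with the same scale and the same `L` as the main game, so that its
  -- regret bound involves the same `L ^ β`.
  obtain ⟨σ, hσ⟩ := A.exists_one_le_regret ⟨n, 2, L, 1, by omega⟩ le_rfl hL2 rfl
  have hone := hσ.trans (hA ⟨n, 2, L, 1, by omega⟩ rfl (by simp only; omega) hLn
    (Nat.one_le_pow _ _ (by omega)) σ)
  simp only [Nat.cast_ofNat, Nat.cast_one] at hone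
  obtain ⟨hqm, hreg⟩ := regret_bounds hC hk1 q.2.1 hη hkm hβ hone
  have hrounds : m * m ≤ n ^ 2 := by
    rw [pow_two]
    exact Nat.mul_le_mul (by omega) (by omega)
  refine ⟨answerProb_binomialRandom_ge hD (by omega) ?_,
    answerProb_plantedRandom_ge hcoins hD ⟨hm0, hmn⟩ hkn'' hp0 ?_ ?_ hpq hqm fun σ => ?_⟩
  · rw [← mul_assoc]
    calc (24 : ℝ) ≤ 1 * (n - 1) := by linarith
      _ ≤ p * n * (n - 1) := mul_le_mul_of_nonneg_right hpn (by linarith)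
  · have h1 : (k : ℝ) ^ 2 * q ≤ k ^ 2 * 1 := mul_le_mul_of_nonneg_left q.2.2 (by positivity)
    have h2 : (n : ℝ) * 1 ≤ n * (p * n) := mul_le_mul_of_nonneg_left hpn hn0.le
    linarith
  · rw [mul_div_assoc', div_le_iff₀ (by linarith)] at hL
    have : ((10 * n : ℕ) : ℝ) ≤ (k * L : ℕ) := by
      push_cast
      linarith
    exact Nat.cast_le.1 this
  · refine (hA (blockGame n m ⟨hm0, hmn⟩) rfl hmn hLn hrounds σ).trans
      (le_trans (le_of_eq ?_) hreg)
    simp only [blockGame]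
    push_cast
    rfl

theorem theorem2 (α ε ε' δ : ℕ → ℝ) (k : ℕ → ℕ) (p q : ℕ → unitInterval)
    (hα : ∃ c : ℝ, 0 < c ∧ ∀ᶠ n : ℕ in atTop, c ≤ α n)
    (hα_le : ∀ᶠ n : ℕ in atTop, α n ≤ 1 / 2)
    (hε : ∃ c : ℝ, 0 < c ∧ ∀ᶠ n : ℕ in atTop, c ≤ ε n)
    (hε' : ∃ c : ℝ, 0 < c ∧ ∀ᶠ n : ℕ in atTop, c ≤ ε' n)
    (hk : ∀ᶠ n : ℕ in atTop, k n = ⌊(n : ℝ) ^ (1 / 2 - ε' n)⌋₊)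
    (hk_ge : ∃ c : ℝ, 0 < c ∧ ∀ᶠ n : ℕ in atTop, (n : ℝ) ^ c ≤ k n)
    (hp : ∀ᶠ n : ℕ in atTop, (p n : ℝ) = (n : ℝ) ^ (-α n))
    (hq : ∀ᶠ n : ℕ in atTop, (q n : ℝ) = (k n : ℝ) ^ (-α n - ε n))
    (hpq : (fun n : ℕ => (p n : ℝ)) =o[atTop] (fun n : ℕ => (q n : ℝ)))
    (hδ : Tendsto (fun n : ℕ => δ n * Real.log n) atTop atTop)
    (hA : ∃ A : Learner, A.AchievesRegret fun n =>
      2 * ((1 / 2 - (1 / 2 - ε' n) * (α n + ε n) - δ n) / (1 / 2 + ε' n)) - 1) :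
    ∃ D : Distinguisher, ∀ᶠ n : ℕ in atTop,
      4 / 5 ≤ D.answerProb (SimpleGraph.binomialRandom (Fin n) (p n)) false ∧
      4 / 5 ≤ D.answerProb (plantedRandom n (p n) (k n) (q n)) true := by
  obtain ⟨A, C, hC⟩ := hA
  obtain ⟨D, hcoins, hD⟩ := A.exists_distinguisher
  obtain ⟨cα, hcα, hα⟩ := hα
  obtain ⟨cε, hcε, hε⟩ := hε
  obtain ⟨cε', hcε', hε'⟩ := hε'
  obtain ⟨c, hc, hk_ge⟩ := hk_ge
  have hkT : ∀ᶠ n : ℕ in atTop, (61440 ^ 2 : ℝ) ≤ (n : ℝ) ^ c :=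
    ((tendsto_rpow_atTop hc).comp tendsto_natCast_atTop_atTop).eventually_ge_atTop _
  -- The constant in the regret bound may be small or negative; it is enlarged so that division by
  -- it is safe.
  have hC1 : 1 ≤ max C 1 := le_max_right _ _
  refine ⟨D, ?_⟩
  filter_upwards [hα, hα_le, hε, hε', hk, hk_ge, hp, hq, hkT, hC,
    hpq.bound (show (0 : ℝ) < 1 / 163840 by norm_num), hδ.eventually_ge_atTop 0,
    hδ.eventually_ge_atTop (Real.log (26214400 * (max C 1) ^ 2) / 2), eventually_ge_atTop 2]
    with n hα hα_le hε hε' hk hk_ge hp hq hkT hC hpq hδ0 hδ hn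
  have hn1 : (1 : ℝ) < n := by exact_mod_cast (by omega : 1 < n)
  refine answerProb_ge_of_regret_le hcoins hD (hcα.le.trans hα) hα_le (hcε.le.trans hε)
    (hcε'.trans_le hε') (nonneg_of_mul_nonneg_left hδ0 (Real.log_pos hn1)) hk ?_ hp hq ?_ hC1 ?_ ?_
  · exact_mod_cast hkT.trans hk_ge
  · rw [Real.norm_of_nonneg (p n).2.1, Real.norm_of_nonneg (q n).2.1] at hpq
    linarith
  -- Here `δ n * log n → ∞` is used: it makes `n ^ (-2δ)` smaller than any given constant.
  · have h1 : (n : ℝ) ^ (-(2 * δ n)) = Real.exp (-(2 * (δ n * Real.log n))) := by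
      rw [Real.rpow_def_of_pos (by linarith)]
      ring_nf
    have h2 : 0 < 26214400 * (max C 1) ^ 2 := by positivity
    rw [h1, Real.exp_neg, mul_inv_le_iff₀ (Real.exp_pos _), one_mul, ← Real.log_le_iff_le_exp h2]
    linarith
  · intro s h1 h2 h3 h4 σ
    refine (hC s h1 h2 h3 h4 σ).trans ?_
    exact mul_le_mul_of_nonneg_right (le_max_left _ _) (Real.sqrt_nonneg _)
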